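/- Let $\Bbbk$ be a field with $\operatorname{char}\Bbbk\neq 2$. A superspace is a finite-dimensional $\mathbb Z/2$-graded $\Bbbk$-vector space $M=M_0\oplus M_1$; $|v|$ denotes the parity of a homogeneous $v$, and $\Pi M$ is $M$ with the opposite grading. **Powers.** For $d\ge 0$ let the symmetric group $\mathfrak S_d$ act on the right of $M^{\otimes d}$ by $(v_1\otimes\cdots\otimes v_d).\sigma=\operatorname{sgn}(v,\sigma)\,v_{\sigma 1}\otimes\cdots\otimes v_{\sigma d}$ for homogeneous $v_i$, where $\operatorname{sgn}(v,\sigma)=\prod_{s<t,\ \sigma^{-1}s>\sigma^{-1}t}(-1)^{|v_s||v_t|}$. Let $S^dM$ be the degree $d$ part of the symmetric superalgebra $T(M)/\langle x\otimes y-(-1)^{|x||y|}y\otimes x\rangle$, with multiplication map $m:M^{\otimes d}\to S^dM$, and let $\Gamma^dM=(S^d(M^*))^*$. The dual of $m:(M^*)^{\otimes d}\to S^d(M^*)$ is an embedding $\Delta:\Gamma^dM\to ((M^*)^{\otimes d})^*= M^{\otimes d}$, where $v_1\otimes\cdots\otimes v_d$ is identified with the functional $f_1\otimes\cdots\otimes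 f_d\mapsto\prod_i f_i(v_i)$. If $(Z_1,\dots,Z_N)$ is a homogeneous basis of $M$ with dual basis $(\check Z_i)$, and $\boldsymbol i=(i_1\le\dots\le i_d)$ is a sequence in which no $i$ with $Z_i$ odd is repeated, then $Z^{(\boldsymbol i)}\in\Gamma^dM$ denotes the functional taking the value $1$ at $\check Z_{i_1}\cdots\check Z_{i_d}$ and $0$ at the monomials of all other such sequences. **Schur superfunctors.** Let $\mu\subseteq\lambda$ be partitions with conjugates $\mu'\subseteq\lambda'$, let $\lambda/\mu$ have $d$ boxes, $q$ rows and $r=\lambda_1$ columns, and put $$\Gamma_\Pi^{\lambda/\mu}(M)=\bigotimes_{i=1}^{q}\Gamma^{\lambda_i-\mu_i}(\Pi M),\qquad S^{\lambda'/\mu'}(M)=\bigotimes_{j=1}^{r}S^{\lambda'_j-\mu'_j}(M).$$ Let $\Delta_\Pi:\Gamma_\Pi^{\lambda/\mu}(M)\to(\Pi M)^{\otimes d}\to M^{\otimes d}$ be the tensor product of the maps $\Delta$ followed by $1^{\otimes d}$, where $1:\Pi M\to M$ is the odd identity map and the rule of signs is used: on homogeneous elements of $\Pi M$, $1^{\otimes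 d}(v_1\otimes\cdots\otimes v_d)=\prod_{s<t}(-1)^{|v_s|}\,v_1\otimes\cdots\otimes v_d$, with parities taken in $\Pi M$. Let $\sigma_{\lambda'/\mu'}\in\mathfrak S_d$ send the number of a box of $\lambda/\mu$ in the reading down the columns, left to right, to its number in the reading along the rows, top to bottom. Define $$\hat\theta_{\lambda'/\mu'}(M):\ \Gamma_\Pi^{\lambda/\mu}(M)\xrightarrow{\ \Delta_\Pi\ }M^{\otimes d}\xrightarrow{\ \cdot\,\sigma_{\lambda'/\mu'}\ }M^{\otimes d}\xrightarrow{\ m\ }S^{\lambda'/\mu'}(M),\qquad \widehat S_{\lambda'/\mu'}(M)=\operatorname{im}\hat\theta_{\lambda'/\mu'}(M),$$ where $m$ is the tensor product of the multiplication maps. Let $\mathcal C_1$ be the Clifford superalgebra with one odd generator $c$, $c^2=1$. For a finite-dimensional right $\mathcal C_1$-supermodule $V$ with underlying superspace $F_{\mathcal C}(V)$, put $\hat\theta^{\mathsf{II}}_{\lambda'/\mu'}(V)=\hat\theta_{\lambda'/\mu'}(F_{\mathcal C}(V))$ and $\widehat S^{\mathsf{II}}_{\lambda'/\mu'}(V)=\widehat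 S_{\lambda'/\mu'}(F_{\mathcal C}(V))$. **Tableaux.** Let $V$ be a finite-dimensional right $\mathcal C_1$-supermodule (so its superdimension is $n|n$ for some $n\ge0$), and let $Z=(Z_1,\dots,Z_{2n})$ be any $\mathbb Z/2$-homogeneous basis of $V$, in any order. Give $[n+n]=\{1,\dots,2n\}$ its usual order and call $i$ even or odd according to the parity of $Z_i$ in $V$. A tableau $\mathfrak t$ of shape $\lambda/\mu$ with entries in $[n+n]$ is costandard if the entries in each row are nondecreasing with only odd entries repeated, and the entries in each column are nondecreasing with only even entries repeated. For a costandard $\mathfrak t$ with rows $\mathfrak t^1,\dots,\mathfrak t^q$ (read left to right) put $Z_\Pi^{(\mathfrak t)}=\bigotimes_{i=1}^q(\Pi Z)^{(\mathfrak t^i)}\in\Gamma_\Pi^{\lambda/\mu}(F_{\mathcal C}(V))$, where $\Pi Z$ is the basis $Z$ regarded as a homogeneous basis of $\Pi V$. **Claim.** For all partitions $\mu\subseteq\lambda$, every such $V$ and every such basis $Z$, the elements $\hat\theta^{\mathsf{II}}_{\lambda'/\mu'}(V)\big(Z_\Pi^{(\mathfrak t)}\big)$, indexed by the costandard tableaux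 $\mathfrak t$ of shape $\lambda/\mu$ with entries in $[n+n]$, form a basis of $\widehat S^{\mathsf{II}}_{\lambda'/\mu'}(V)$. -/

import Mathlib

universe u v

open scoped TensorProduct

noncomputable section

namespace SuperSchur

/-- The sign `(-1)^(a b)` of the rule of signs. -/
def koszul (a b : ZMod 2) : ℤ := if a = 1 ∧ b = 1 then -1 else 1

section Powers

variable {k : Type u} [Field k] {M : Type v} [AddCommGroup M] [Module k M]

/-- The homogeneous projection `M → M_ε ⊆ M` of a superspace `M = M_0 ⊕ M_1`. -/
def superProj (G : ZMod 2 → Submodule k M) [DirectSum.Decomposition G] (ε : ZMod 2) :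
    M →ₗ[k] M :=
  (G ε).subtype ∘ₗ DirectSum.component k (ZMod 2) (fun i => G i) ε ∘ₗ
    (DirectSum.decomposeLinearEquiv G).toLinearMap

/-- The grading of `ΠM`: the same vector space with the opposite grading. -/
def parityShift (G : ZMod 2 → Submodule k M) : ZMod 2 → Submodule k M := fun ε => G (ε + 1)

/-- The grading of the dual `M^* = Hom(M, k)`, where `k` is concentrated in degree `0`:
a functional has degree `ε` when it vanishes on every `M_δ` with `δ ≠ ε`. -/
def dualGrading (G : ZMod 2 → Submodule k M) (ε : ZMod 2) : Submodule k (Module.Dual k M) where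
  carrier := {f | ∀ δ, δ ≠ ε → ∀ v ∈ G δ, f v = 0}
  add_mem' := by
    intro f g hf hg δ hδ v hv
    simp [hf δ hδ v hv, hg δ hδ v hv]
  zero_mem' := by
    intro δ _ v _
    simp
  smul_mem' := by
    intro c f hf δ hδ v hv
    simp [hf δ hδ v hv]

/-- The degree `d` component of the two-sided ideal of the tensor algebra of `M` generated by the
elements `x ⊗ y - (-1)^(|x||y|) y ⊗ x`, for `x`, `y` homogeneous. -/
def symRel (G : ZMod 2 → Submodule k M) (d : ℕ) : Submodule k (⨂[k]^d M) :=
  Submodule.span k {x | ∃ (v : Fin d → M) (a b : Fin d) (α β : ZMod 2),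
    (a : ℕ) + 1 = b ∧ v a ∈ G α ∧ v b ∈ G β ∧
      x = PiTensorProduct.tprod k v -
        (koszul α β : k) • PiTensorProduct.tprod k (fun s => v (Equiv.swap a b s))}

/-- The symmetric power `S^d M`: the degree `d` component of the symmetric superalgebra of `M`. -/
def SymPow (G : ZMod 2 → Submodule k M) (d : ℕ) : Type (max u v) := (⨂[k]^d M) ⧸ symRel G d

instance (G : ZMod 2 → Submodule k M) (d : ℕ) : AddCommGroup (SymPow G d) :=
  inferInstanceAs (AddCommGroup ((⨂[k]^d M) ⧸ symRel G d))

instance (G : ZMod 2 → Submodule k M) (d : ℕ) : Module k (SymPow G d) :=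
  inferInstanceAs (Module k ((⨂[k]^d M) ⧸ symRel G d))

/-- The `d`-fold multiplication `M^{⊗ d} → S^d M` of the symmetric superalgebra. -/
def symMul (G : ZMod 2 → Submodule k M) (d : ℕ) : (⨂[k]^d M) →ₗ[k] SymPow G d :=
  (symRel G d).mkQ

/-- The map out of `S^d M` induced by a map out of `M^{⊗ d}` that kills the relations. -/
def symLift (G : ZMod 2 → Submodule k M) (d : ℕ) {N : Type*} [AddCommGroup N] [Module k N]
    (φ : (⨂[k]^d M) →ₗ[k] N) (h : symRel G d ≤ LinearMap.ker φ) : SymPow G d →ₗ[k] N :=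
  (symRel G d).liftQ φ h

theorem symLift_symMul (G : ZMod 2 → Submodule k M) (d : ℕ) {N : Type*} [AddCommGroup N]
    [Module k N] (φ : (⨂[k]^d M) →ₗ[k] N) (h : symRel G d ≤ LinearMap.ker φ) (x : ⨂[k]^d M) :
    symLift G d φ h (symMul G d x) = φ x := rfl

/-- The divided power `Γ^d M = S^d(M^*)^*`. -/
abbrev DivPow (G : ZMod 2 → Submodule k M) (d : ℕ) : Type _ :=
  Module.Dual k (SymPow (dualGrading G) d)

/-- The canonical isomorphism `M^{⊗ d} ≃ ((M^*)^{⊗ d})^*`, which sends `v_1 ⊗ ⋯ ⊗ v_d` to the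
functional `f_1 ⊗ ⋯ ⊗ f_d ↦ f_1(v_1) ⋯ f_d(v_d)`. -/
def tensorEval (k : Type u) [Field k] (M : Type v) [AddCommGroup M] [Module k M]
    [Module.Finite k M] (d : ℕ) : (⨂[k]^d M) ≃ₗ[k] Module.Dual k (⨂[k]^d (Module.Dual k M)) :=
  (PiTensorProduct.congr (fun _ : Fin d => Module.evalEquiv k M)).trans
    PiTensorProduct.dualDistribEquiv

theorem tensorEval_tprod [Module.Finite k M] (d : ℕ) (v : Fin d → M)
    (f : Fin d → Module.Dual k M) :
    tensorEval k M d (PiTensorProduct.tprod k v) (PiTensorProduct.tprod k f) =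
      ∏ s, f s (v s) := by
  simp [tensorEval, PiTensorProduct.dualDistribEquivOfBasis]

/-- The embedding `Δ : Γ^d M → M^{⊗ d}`, dual to the multiplication `(M^*)^{⊗ d} → S^d(M^*)`. -/
def divComul (G : ZMod 2 → Submodule k M) [Module.Finite k M] (d : ℕ) :
    DivPow G d →ₗ[k] ⨂[k]^d M :=
  (tensorEval k M d).symm.toLinearMap ∘ₗ (symMul (dualGrading G) d).dualMap

/-- The sign `sgn(ε, σ)`, the product of `(-1)^(ε_s ε_t)` over all `s < t` with
`σ⁻¹ s > σ⁻¹ t`. -/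
def superSign {d d' : ℕ} (ε : Fin d → ZMod 2) (σ : Fin d' ≃ Fin d) : ℤ :=
  ∏ s, ∏ t, if s < t ∧ σ.symm t < σ.symm s then koszul (ε s) (ε t) else 1

/-- The right action of the symmetric group on tensor powers of a superspace: for homogeneous
`v_1, …, v_d` of parities `ε_1, …, ε_d`,
`(v_1 ⊗ ⋯ ⊗ v_d).σ = sgn(ε, σ) v_{σ 1} ⊗ ⋯ ⊗ v_{σ d}`. -/
def superPerm (G : ZMod 2 → Submodule k M) [DirectSum.Decomposition G] {d d' : ℕ}
    (σ : Fin d' ≃ Fin d) : (⨂[k]^d M) →ₗ[k] ⨂[k]^d' M :=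
  ∑ ε : Fin d → ZMod 2, (superSign ε σ : k) •
    ((PiTensorProduct.reindex k (fun _ => M) σ.symm).toLinearMap ∘ₗ
      PiTensorProduct.map (fun s => superProj G (ε s)))

/-- The tensor power `1^{⊗ d} : (ΠM)^{⊗ d} → M^{⊗ d}` of the odd map `1 : ΠM → M`. By the rule of
signs, `(1 ⊗ ⋯ ⊗ 1)(v_1 ⊗ ⋯ ⊗ v_d)` acquires a sign `(-1)^(ε_s)` for each `s < t`, where `ε_s` is
the parity of `v_s` in `ΠM` (so that `v_s` has parity `ε_s + 1` in `M`). -/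
def shiftTensor (G : ZMod 2 → Submodule k M) [DirectSum.Decomposition G] (d : ℕ) :
    (⨂[k]^d M) →ₗ[k] ⨂[k]^d M :=
  ∑ ε : Fin d → ZMod 2, ((∏ s, ∏ t, if s < t then koszul 1 (ε s) else 1 : ℤ) : k) •
    PiTensorProduct.map (fun s => superProj G (ε s + 1))

/-- The associativity isomorphism
`⨂_{(i, j)} M ≃ ⨂_i (⨂_j M)`, `⨂_{(i, j)} v_{ij} ↦ ⨂_i (⨂_j v_{ij})`. -/
def tensorSigmaEquiv (k : Type u) [Field k] (M : Type v) [AddCommGroup M] [Module k M]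
    {q : ℕ} (n : Fin q → ℕ) :
    (⨂[k] _x : (Σ i : Fin q, Fin (n i)), M) ≃ₗ[k] ⨂[k] i : Fin q, (⨂[k]^(n i) M) :=
  (Basis.piTensorProduct (fun _ : (Σ i : Fin q, Fin (n i)) => Module.Free.chooseBasis k M)).equiv
    (Basis.piTensorProduct (fun i : Fin q =>
      Basis.piTensorProduct (fun _ : Fin (n i) => Module.Free.chooseBasis k M)))
    (Equiv.piCurry (fun _ _ => Module.Free.ChooseBasisIndex k M))

theorem tensorSigmaEquiv_tprod {q : ℕ} (n : Fin q → ℕ) (v : (Σ i : Fin q, Fin (n i)) → M) :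
    tensorSigmaEquiv k M n (PiTensorProduct.tprod k v) =
      PiTensorProduct.tprod k (fun i => PiTensorProduct.tprod k (fun j => v ⟨i, j⟩)) := by
  have key : ∀ {α β : Type v} {V W : Type (max u v)} [AddCommGroup V] [Module k V]
      [AddCommGroup W] [Module k W]
      (b : Module.Basis α k V) (b' : Module.Basis β k W) (e : α ≃ β) (x : V) (y : α),
      b'.repr (b.equiv b' e x) (e y) = b.repr x y := by
    intro α β V W _ _ _ _ b b' e x y
    have h : (b'.reindex e.symm).repr (b.equiv b' e x) = b.repr x := by
      simp only [Module.Basis.equiv, LinearEquiv.trans_apply]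
      exact LinearEquiv.apply_symm_apply _ _
    rw [← h]
    simp
  refine (Basis.piTensorProduct (fun i : Fin q =>
    Basis.piTensorProduct (fun _ : Fin (n i) => Module.Free.chooseBasis k M))).ext_elem ?_
  intro x
  obtain ⟨y, rfl⟩ := (Equiv.piCurry (fun _ _ => Module.Free.ChooseBasisIndex k M)).surjective x
  rw [tensorSigmaEquiv, key, Basis.piTensorProduct_repr_tprod_apply,
    Basis.piTensorProduct_repr_tprod_apply]
  simp only [Basis.piTensorProduct_repr_tprod_apply, Fintype.prod_sigma]
  rfl

/-- Concatenation `⨂_i M^{⊗ n_i} ≃ M^{⊗ (n_1 + ⋯ + n_q)}`. -/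
def concat (k : Type u) [Field k] (M : Type v) [AddCommGroup M] [Module k M]
    {q : ℕ} (n : Fin q → ℕ) :
    (⨂[k] i : Fin q, (⨂[k]^(n i) M)) ≃ₗ[k] ⨂[k]^(∑ i, n i) M :=
  (tensorSigmaEquiv k M n).symm.trans
    (PiTensorProduct.reindex k (fun _ => M) finSigmaFinEquiv)

end Powers

section DividedBasis

variable {ι : Type} [LinearOrder ι]

/-- A word is restricted when no odd letter is repeated. -/
def IsRestricted (p : ι → ZMod 2) {d : ℕ} (w : Fin d → ι) : Prop :=
  ∀ s t, w s = w t → p (w s) = 1 → s = t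

/-- The sign of the permutation that sorts a word into nondecreasing order: the product of
`(-1)^(|w_s||w_t|)` over all `s < t` with `w_s > w_t`. -/
def wordSign (p : ι → ZMod 2) {d : ℕ} (w : Fin d → ι) : ℤ :=
  ∏ s, ∏ t, if s < t ∧ w t < w s then koszul (p (w s)) (p (w t)) else 1

open Classical in
/-- The value at the monomial `Ž_{j_1} ⋯ Ž_{j_d}` of the functional dual to `Ž_{i_1} ⋯ Ž_{i_d}`:
it is the sign relating the two monomials if `j` is a rearrangement of `i`, and `0` otherwise. -/
def dualCoeff (p : ι → ZMod 2) {d : ℕ} (i j : Fin d → ι) : ℤ :=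
  if IsRestricted p i ∧ ∃ τ : Equiv.Perm (Fin d), ∀ s, j s = i (τ s) then
    wordSign p i * wordSign p j else 0

theorem koszul_mul_self (a b : ZMod 2) : koszul a b * koszul a b = 1 := by
  unfold koszul
  split_ifs <;> norm_num

theorem wordSign_mul_self (p : ι → ZMod 2) {d : ℕ} (w : Fin d → ι) :
    wordSign p w * wordSign p w = 1 := by
  unfold wordSign
  rw [← Finset.prod_mul_distrib]
  refine Finset.prod_eq_one fun s _ => ?_
  rw [← Finset.prod_mul_distrib]
  refine Finset.prod_eq_one fun t _ => ?_
  split_ifs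
  · exact koszul_mul_self _ _
  · norm_num

theorem wordSign_swap (p : ι → ZMod 2) {d : ℕ} (w : Fin d → ι) (a b : Fin d)
    (hab : (a : ℕ) + 1 = b) (hw : ¬ (w a = w b ∧ p (w a) = 1)) :
    wordSign p (fun s => w (Equiv.swap a b s)) = koszul (p (w a)) (p (w b)) * wordSign p w := by
  have hlt : a < b := by rw [Fin.lt_def]; omega
  have hne : a ≠ b := ne_of_lt hlt
  have hsymm : ∀ x y, koszul x y = koszul y x := by
    intro x y; unfold koszul; simp only [and_comm]
  have key : wordSign p (fun s => w (Equiv.swap a b s)) * wordSign p w =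
      koszul (p (w a)) (p (w b)) := by
    have h1 : wordSign p (fun s => w (Equiv.swap a b s)) =
        ∏ x : Fin d × Fin d, if Equiv.swap a b x.1 < Equiv.swap a b x.2 ∧ w x.2 < w x.1 then
          koszul (p (w x.1)) (p (w x.2)) else 1 := by
      unfold wordSign
      rw [← Fintype.prod_prod_type', ← Equiv.prod_comp
        (Equiv.prodCongr (Equiv.swap a b) (Equiv.swap a b))]
      refine Finset.prod_congr rfl fun x _ => ?_
      simp [Equiv.swap_apply_self]
    have h2 : wordSign p w = ∏ x : Fin d × Fin d, if x.1 < x.2 ∧ w x.2 < w x.1 then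
          koszul (p (w x.1)) (p (w x.2)) else 1 := by
      unfold wordSign
      rw [← Fintype.prod_prod_type']
    rw [h1, h2, ← Finset.prod_mul_distrib]
    rw [Finset.prod_eq_mul (a, b) (b, a)]
    · simp only [Equiv.swap_apply_left, Equiv.swap_apply_right, hlt, not_lt.2 hlt.le, true_and,
        false_and, if_false, one_mul, mul_one]
      rcases lt_trichotomy (w a) (w b) with h | h | h
      · simp [h, not_lt.2 h.le, hsymm]
      · have hp : p (w a) ≠ 1 := fun hp => hw ⟨h, hp⟩
        rw [h] at hp
        simp [h, koszul, hp]
      · simp [h, not_lt.2 h.le]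
    · simp [hne]
    · rintro ⟨s, t⟩ _ ⟨hst, hts⟩
      have hiff : (Equiv.swap a b s < Equiv.swap a b t) ↔ s < t := by
        simp only [ne_eq, Prod.mk.injEq, not_and] at hst hts
        simp only [Equiv.swap_apply_def, Fin.lt_def]
        simp only [Fin.ext_iff] at *
        split_ifs <;> omega
      simp only [hiff]
      split_ifs
      · exact koszul_mul_self _ _
      · norm_num
    · simp
    · simp
  calc _ = wordSign p (fun s => w (Equiv.swap a b s)) * (wordSign p w * wordSign p w) := by
        rw [wordSign_mul_self, mul_one]
    _ = _ := by rw [← mul_assoc, key]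

theorem dualCoeff_swap (p : ι → ZMod 2) {d : ℕ} (i j : Fin d → ι) (a b : Fin d)
    (hab : (a : ℕ) + 1 = b) :
    dualCoeff p i (fun s => j (Equiv.swap a b s)) =
      koszul (p (j a)) (p (j b)) * dualCoeff p i j := by
  have hiff : (∃ τ : Equiv.Perm (Fin d), ∀ s, j (Equiv.swap a b s) = i (τ s)) ↔
      ∃ τ : Equiv.Perm (Fin d), ∀ s, j s = i (τ s) := by
    constructor
    · rintro ⟨τ, h⟩
      refine ⟨(Equiv.swap a b).trans τ, fun s => ?_⟩
      have := h (Equiv.swap a b s)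
      rwa [Equiv.swap_apply_self] at this
    · rintro ⟨τ, h⟩
      exact ⟨(Equiv.swap a b).trans τ, fun s => h _⟩
  rw [dualCoeff, dualCoeff]
  by_cases h : IsRestricted p i ∧ ∃ τ : Equiv.Perm (Fin d), ∀ s, j s = i (τ s)
  · obtain ⟨hi, τ, hτ⟩ := h
    rw [if_pos ⟨hi, hiff.2 ⟨τ, hτ⟩⟩, if_pos ⟨hi, τ, hτ⟩, wordSign_swap p j a b hab]
    · ring
    · rintro ⟨h1, h2⟩
      rw [hτ a, hτ b] at h1
      rw [hτ a] at h2
      have := τ.injective (hi _ _ h1 h2)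
      rw [this] at hab
      omega
  · rw [if_neg h, if_neg (fun h' => h ⟨h'.1, hiff.1 h'.2⟩), mul_zero]

variable [Fintype ι] {k : Type u} [Field k] {M : Type v} [AddCommGroup M] [Module k M]

/-- The functional on `(M^*)^{⊗ d}` with value `dualCoeff p i j` at `Ž_{j_1} ⊗ ⋯ ⊗ Ž_{j_d}`. -/
def dualFunctional (b : Module.Basis ι k M) (p : ι → ZMod 2) {d : ℕ} (i : Fin d → ι) :
    (⨂[k]^d (Module.Dual k M)) →ₗ[k] k :=
  ∑ j : Fin d → ι, (dualCoeff p i j : k) • PiTensorProduct.lift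
    ((MultilinearMap.mkPiAlgebra k (Fin d) k).compLinearMap
      (fun s => Module.Dual.eval k M (b (j s))))

theorem dualFunctional_tprod (b : Module.Basis ι k M) (p : ι → ZMod 2) {d : ℕ} (i : Fin d → ι)
    (f : Fin d → Module.Dual k M) :
    dualFunctional b p i (PiTensorProduct.tprod k f) =
      ∑ j : Fin d → ι, (dualCoeff p i j : k) * ∏ s, f s (b (j s)) := by
  simp [dualFunctional]

theorem dualFunctional_symRel (G : ZMod 2 → Submodule k M) (b : Module.Basis ι k M)
    (p : ι → ZMod 2) (hb : ∀ j, b j ∈ G (p j)) {d : ℕ} (i : Fin d → ι) :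
    symRel (dualGrading G) d ≤ LinearMap.ker (dualFunctional b p i) := by
  refine Submodule.span_le.2 ?_
  rintro x ⟨f, s, t, α, β, hst, hs, ht, rfl⟩
  have hs' : ∀ δ, δ ≠ α → ∀ v ∈ G δ, f s v = 0 := hs
  have ht' : ∀ δ, δ ≠ β → ∀ v ∈ G δ, f t v = 0 := ht
  simp only [SetLike.mem_coe, LinearMap.mem_ker, map_sub, map_smul, dualFunctional_tprod]
  have h1 : ∑ j : Fin d → ι, (dualCoeff p i j : k) * ∏ r, f (Equiv.swap s t r) (b (j r)) =
      ∑ j : Fin d → ι, (dualCoeff p i (fun r => j (Equiv.swap s t r)) : k) *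
        ∏ r, f r (b (j r)) := by
    rw [← Equiv.sum_comp (Equiv.arrowCongr (Equiv.swap s t) (Equiv.refl ι))]
    refine Finset.sum_congr rfl fun j _ => ?_
    congr 1
    rw [← Equiv.prod_comp (Equiv.swap s t)]
    simp
  rw [h1, sub_eq_zero, smul_eq_mul, Finset.mul_sum]
  refine Finset.sum_congr rfl fun j _ => ?_
  by_cases hα : p (j s) = α
  · by_cases hβ : p (j t) = β
    · rw [dualCoeff_swap p i j s t hst, hα, hβ, ← mul_assoc, ← Int.cast_mul, ← mul_assoc,
        koszul_mul_self, one_mul]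
    · rw [Finset.prod_eq_zero (Finset.mem_univ t) (ht' _ hβ _ (hb _))]
      simp
  · rw [Finset.prod_eq_zero (Finset.mem_univ s) (hs' _ hα _ (hb _))]
    simp

/-- The divided power monomial `Z^{(i)} ∈ Γ^d M = S^d(M^*)^*`, for a homogeneous basis `Z` of `M`
with dual basis `Ž`: the functional dual to the monomial `Ž_{i_1} ⋯ Ž_{i_d}`. -/
def divMonomial (G : ZMod 2 → Submodule k M) (b : Module.Basis ι k M) (p : ι → ZMod 2)
    (hb : ∀ j, b j ∈ G (p j)) {d : ℕ} (i : Fin d → ι) : DivPow G d :=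
  symLift (dualGrading G) d (dualFunctional b p i) (dualFunctional_symRel G b p hb i)

theorem divMonomial_monomial (G : ZMod 2 → Submodule k M) (b : Module.Basis ι k M)
    (p : ι → ZMod 2) (hb : ∀ j, b j ∈ G (p j)) {d : ℕ} (i j : Fin d → ι) :
    divMonomial G b p hb i
      (symMul (dualGrading G) d (PiTensorProduct.tprod k (fun s => b.coord (j s)))) =
      dualCoeff p i j := by
  classical
  rw [divMonomial, symLift_symMul, dualFunctional_tprod, Finset.sum_eq_single j]
  · simp
  · intro l _ hl
    obtain ⟨s, hs⟩ := Function.ne_iff.1 hl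
    rw [Finset.prod_eq_zero (Finset.mem_univ s)]
    · simp
    · simp [hs]
  · simp

/-- Among the basis monomials of `S^d(M^*)` (those of nondecreasing restricted words),
`Z^{(i)}` is `1` at the monomial of `i` and `0` at all others. -/
theorem divMonomial_dual (G : ZMod 2 → Submodule k M) (b : Module.Basis ι k M)
    (p : ι → ZMod 2) (hb : ∀ j, b j ∈ G (p j)) {d : ℕ} (i j : Fin d → ι)
    (hi : Monotone i) (hj : Monotone j) (hri : IsRestricted p i) :
    divMonomial G b p hb i
      (symMul (dualGrading G) d (PiTensorProduct.tprod k (fun s => b.coord (j s)))) =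
      (open Classical in if j = i then 1 else 0) := by
  rw [divMonomial_monomial]
  split_ifs with h
  · subst h
    have : ∃ τ : Equiv.Perm (Fin d), ∀ s, j s = j (τ s) := ⟨Equiv.refl _, fun _ => rfl⟩
    simp [dualCoeff, hri, this, wordSign_mul_self]
  · unfold dualCoeff
    rw [if_neg]
    · simp
    · rintro ⟨-, τ, hτ⟩
      refine h ?_
      have h1 : j = i ∘ τ := funext hτ
      have := Tuple.unique_monotone (f := i) (σ := τ) (τ := Equiv.refl _) (h1 ▸ hj) hi
      rw [h1]
      exact this

end DividedBasis

theorem superProj_of_mem {k : Type u} [Field k] {M : Type v} [AddCommGroup M] [Module k M]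
    (G : ZMod 2 → Submodule k M) [DirectSum.Decomposition G] {δ : ZMod 2} (ε : ZMod 2) {v : M}
    (hv : v ∈ G δ) : superProj G ε v = if ε = δ then v else 0 := by
  have : superProj G ε v = (DirectSum.decompose G v ε : M) := rfl
  rw [this]
  split_ifs with h
  · subst h; exact DirectSum.decompose_of_mem_same G hv
  · exact DirectSum.decompose_of_mem_ne G hv (Ne.symm h)

theorem sum_proj_tprod {k : Type u} [Field k] {M : Type v} [AddCommGroup M] [Module k M]
    (G : ZMod 2 → Submodule k M) [DirectSum.Decomposition G] {d : ℕ} (v : Fin d → M)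
    (ε : Fin d → ZMod 2) (hv : ∀ s, v s ∈ G (ε s)) (η : Fin d → ZMod 2) :
    PiTensorProduct.tprod k (fun s => superProj G (η s) (v s)) =
      if η = ε then PiTensorProduct.tprod k v else 0 := by
  split_ifs with h
  · subst h
    simp [superProj_of_mem G _ (hv _)]
  · obtain ⟨s, hs⟩ := Function.ne_iff.1 h
    refine (PiTensorProduct.tprod k).map_coord_zero s ?_
    rw [superProj_of_mem G _ (hv s), if_neg hs]

theorem superPerm_tprod {k : Type u} [Field k] {M : Type v} [AddCommGroup M] [Module k M]
    (G : ZMod 2 → Submodule k M) [DirectSum.Decomposition G] {d d' : ℕ} (σ : Fin d' ≃ Fin d)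
    (v : Fin d → M) (ε : Fin d → ZMod 2) (hv : ∀ s, v s ∈ G (ε s)) :
    superPerm G σ (PiTensorProduct.tprod k v) =
      (superSign ε σ : k) • PiTensorProduct.tprod k (fun s => v (σ s)) := by
  simp only [superPerm, LinearMap.sum_apply, LinearMap.smul_apply, LinearMap.comp_apply,
    PiTensorProduct.map_tprod, sum_proj_tprod G v ε hv]
  rw [Finset.sum_eq_single ε]
  · rw [if_pos rfl]
    simp [PiTensorProduct.reindex_tprod]
  · intro η _ hη
    simp [hη]
  · simp

theorem shiftTensor_tprod {k : Type u} [Field k] {M : Type v} [AddCommGroup M] [Module k M]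
    (G : ZMod 2 → Submodule k M) [DirectSum.Decomposition G] {d : ℕ}
    (v : Fin d → M) (ε : Fin d → ZMod 2) (hv : ∀ s, v s ∈ parityShift G (ε s)) :
    shiftTensor G d (PiTensorProduct.tprod k v) =
      ((∏ s, ∏ t, if s < t then koszul 1 (ε s) else 1 : ℤ) : k) • PiTensorProduct.tprod k v := by
  simp only [shiftTensor, LinearMap.sum_apply, LinearMap.smul_apply,
    PiTensorProduct.map_tprod]
  rw [Finset.sum_eq_single ε]
  · rw [sum_proj_tprod G v (fun s => ε s + 1) hv (fun s => ε s + 1), if_pos rfl]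
  · intro η _ hη
    rw [sum_proj_tprod G v (fun s => ε s + 1) hv (fun s => η s + 1), if_neg, smul_zero]
    intro h
    exact hη (funext fun s => by simpa using congrFun h s)
  · simp

section Diagrams

/-- The skew diagram of `lam/mu`, with rows and columns numbered from `0`. -/
abbrev Box (lam mu : YoungDiagram) : Type := {c : ℕ × ℕ // c ∈ lam ∧ c ∉ mu}

/-- The length `lam_i - mu_i` of the `i`-th row of `lam/mu`. -/
abbrev skewRow (lam mu : YoungDiagram) (i : Fin (lam.colLen 0)) : ℕ := lam.rowLen i - mu.rowLen i

/-- The length `lam'_j - mu'_j` of the `j`-th column of `lam/mu`. -/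
abbrev skewCol (lam mu : YoungDiagram) (j : Fin (lam.rowLen 0)) : ℕ := lam.colLen j - mu.colLen j

/-- The boxes of `lam/mu`, listed by row and by position in the row. -/
def rowBox (lam mu : YoungDiagram) :
    (Σ i : Fin (lam.colLen 0), Fin (skewRow lam mu i)) ≃ Box lam mu where
  toFun x := ⟨(x.1, mu.rowLen x.1 + x.2), by
    have := x.2.2
    simp only [skewRow] at this
    simp only [YoungDiagram.mem_iff_lt_rowLen]
    omega⟩
  invFun c := ⟨⟨c.1.1, YoungDiagram.mem_iff_lt_colLen.1
      (lam.up_left_mem le_rfl (Nat.zero_le _) c.2.1)⟩, ⟨c.1.2 - mu.rowLen c.1.1, by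
    obtain ⟨⟨a, b⟩, h1, h2⟩ := c
    rw [YoungDiagram.mem_iff_lt_rowLen] at h1 h2
    simp only [skewRow]
    omega⟩⟩
  left_inv x := by
    obtain ⟨i, r⟩ := x
    simp
  right_inv c := by
    obtain ⟨⟨a, b⟩, h1, h2⟩ := c
    rw [YoungDiagram.mem_iff_lt_rowLen] at h1 h2
    ext
    · simp
    · simp only
      omega

/-- The boxes of `lam/mu`, listed by column and by position in the column. -/
def colBox (lam mu : YoungDiagram) :
    (Σ j : Fin (lam.rowLen 0), Fin (skewCol lam mu j)) ≃ Box lam mu where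
  toFun x := ⟨(mu.colLen x.1 + x.2, x.1), by
    have := x.2.2
    simp only [skewCol] at this
    simp only [YoungDiagram.mem_iff_lt_colLen]
    omega⟩
  invFun c := ⟨⟨c.1.2, YoungDiagram.mem_iff_lt_rowLen.1
      (lam.up_left_mem (Nat.zero_le _) le_rfl c.2.1)⟩, ⟨c.1.1 - mu.colLen c.1.2, by
    obtain ⟨⟨a, b⟩, h1, h2⟩ := c
    rw [YoungDiagram.mem_iff_lt_colLen] at h1 h2
    simp only [skewCol]
    omega⟩⟩
  left_inv x := by
    obtain ⟨i, r⟩ := x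
    simp
  right_inv c := by
    obtain ⟨⟨a, b⟩, h1, h2⟩ := c
    rw [YoungDiagram.mem_iff_lt_colLen] at h1 h2
    ext
    · simp only
      omega
    · simp

/-- The number of a box of `lam/mu` in the reading along the rows, top to bottom. -/
def rowNumber (lam mu : YoungDiagram) : Box lam mu ≃ Fin (∑ i, skewRow lam mu i) :=
  (rowBox lam mu).symm.trans finSigmaFinEquiv

/-- The number of a box of `lam/mu` in the reading down the columns, left to right; equivalently,
the number of the corresponding box of `lam'/mu'` in the reading along the rows. -/
def colNumber (lam mu : YoungDiagram) : Box lam mu ≃ Fin (∑ j, skewCol lam mu j) :=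
  (colBox lam mu).symm.trans finSigmaFinEquiv

/-- The permutation `σ_{lam'/mu'}` of `{1, …, d}`: it sends the number of a box in the reading of
`lam'/mu'` along the rows to its number in the reading of `lam'/mu'` down the columns, that is, the
column number in `lam/mu` to the row number in `lam/mu`. -/
def sigmaConj (lam mu : YoungDiagram) :
    Fin (∑ j, skewCol lam mu j) ≃ Fin (∑ i, skewRow lam mu i) :=
  (colNumber lam mu).symm.trans (rowNumber lam mu)

/-- Tableaux of shape `lam/mu` with values in `ι`. -/
abbrev Tableau (lam mu : YoungDiagram) (ι : Type) : Type := Box lam mu → ι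

variable {lam mu : YoungDiagram} {ι : Type} [LinearOrder ι]

/-- Rows are nondecreasing and repeated entries in a row are odd. -/
def IsRowCostandard (p : ι → ZMod 2) (t : Tableau lam mu ι) : Prop :=
  ∀ c c' : Box lam mu, c.1.1 = c'.1.1 → c.1.2 < c'.1.2 →
    t c ≤ t c' ∧ (t c = t c' → p (t c) = 1)

/-- Columns are nondecreasing and repeated entries in a column are even. -/
def IsColCostandard (p : ι → ZMod 2) (t : Tableau lam mu ι) : Prop :=
  ∀ c c' : Box lam mu, c.1.2 = c'.1.2 → c.1.1 < c'.1.1 →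
    t c ≤ t c' ∧ (t c = t c' → p (t c) = 0)

/-- Costandard tableaux. -/
def IsCostandard (p : ι → ZMod 2) (t : Tableau lam mu ι) : Prop :=
  IsRowCostandard p t ∧ IsColCostandard p t

/-- The word formed by the entries of the `i`-th row of a tableau, read from left to right. -/
def rowWord (t : Tableau lam mu ι) (i : Fin (lam.colLen 0)) : Fin (skewRow lam mu i) → ι :=
  fun r => t (rowBox lam mu ⟨i, r⟩)

end Diagrams

section Superfunctors

variable (k : Type u) [Field k]

/-- Finite dimensional vector superspaces. -/
structure Superspace where
  /-- The underlying vector space. -/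
  carrier : Type v
  [addCommGroup : AddCommGroup carrier]
  [module : Module k carrier]
  [finite : Module.Finite k carrier]
  /-- The homogeneous components. -/
  grading : ZMod 2 → Submodule k carrier
  [decomposition : DirectSum.Decomposition grading]

attribute [instance] Superspace.addCommGroup Superspace.module Superspace.finite
  Superspace.decomposition

/-- The Clifford superalgebra `C_1`, with one odd generator `c` such that `c ^ 2 = 1`; its
`ZMod 2`-grading is `CliffordAlgebra.evenOdd`. -/
abbrev CliffordOne : Type u := CliffordAlgebra (QuadraticMap.sq : QuadraticForm k k)

theorem cliffordOne_gen_sq :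
    CliffordAlgebra.ι (QuadraticMap.sq : QuadraticForm k k) 1 *
      CliffordAlgebra.ι (QuadraticMap.sq : QuadraticForm k k) 1 = 1 := by
  simp [CliffordAlgebra.ι_sq_scalar]

/-- Finite dimensional right `C_1`-supermodules. -/
structure CliffordSupermodule extends Superspace.{u, v} k where
  [rightModule : Module (CliffordOne k)ᵐᵒᵖ carrier]
  [scalarTower : IsScalarTower k (CliffordOne k)ᵐᵒᵖ carrier]
  graded : ∀ (ε δ : ZMod 2), ∀ a ∈ CliffordAlgebra.evenOdd (QuadraticMap.sq : QuadraticForm k k) ε,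
    ∀ v ∈ grading δ, MulOpposite.op a • v ∈ grading (ε + δ)

variable {k}

/-- The functor `F_C` that forgets the action of `C_1`. -/
abbrev CliffordSupermodule.forget (V : CliffordSupermodule.{u, v} k) : Superspace.{u, v} k :=
  V.toSuperspace

variable (M : Superspace.{u, v} k) (lam mu : YoungDiagram)

/-- `Γ_Π^{lam/mu}(M) = ⨂_i Γ^{lam_i - mu_i}(ΠM)`. -/
abbrev GammaPi : Type (max u v) :=
  ⨂[k] i : Fin (lam.colLen 0), DivPow (parityShift M.grading) (skewRow lam mu i)

/-- `S^{lam'/mu'}(M) = ⨂_j S^{lam'_j - mu'_j}(M)`. -/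
abbrev SymConj : Type (max u v) :=
  ⨂[k] j : Fin (lam.rowLen 0), SymPow M.grading (skewCol lam mu j)

/-- `Δ_Π : Γ_Π^{lam/mu}(M) → (ΠM)^{⊗ d} → M^{⊗ d}`, the tensor product of the embeddings `Δ`
followed by `1^{⊗ d}`. -/
def deltaPi : GammaPi M lam mu →ₗ[k] ⨂[k]^(∑ i, skewRow lam mu i) M.carrier :=
  shiftTensor M.grading _ ∘ₗ (concat k M.carrier (skewRow lam mu)).toLinearMap ∘ₗ
    PiTensorProduct.map (fun i => divComul (parityShift M.grading) (skewRow lam mu i))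

/-- `m : M^{⊗ d} → S^{lam'/mu'}(M)`, the tensor product of the multiplication maps. -/
def mulConj : (⨂[k]^(∑ j, skewCol lam mu j) M.carrier) →ₗ[k] SymConj M lam mu :=
  PiTensorProduct.map (fun j => symMul M.grading (skewCol lam mu j)) ∘ₗ
    (concat k M.carrier (skewCol lam mu)).symm.toLinearMap

/-- The component at `M` of `θ̂_{lam'/mu'} : Γ_Π^{lam/mu} → S^{lam'/mu'}`. -/
def thetaConj : GammaPi M lam mu →ₗ[k] SymConj M lam mu :=
  mulConj M lam mu ∘ₗ superPerm M.grading (sigmaConj lam mu) ∘ₗ deltaPi M lam mu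

/-- The Schur superfunctor of type I of shape `lam'/mu'` at `M`: the image of `θ̂_{lam'/mu'}(M)`. -/
def schurConj : Submodule k (SymConj M lam mu) := LinearMap.range (thetaConj M lam mu)

/-- The component at `V` of `θ̂^II_{lam'/mu'}`, the composition of `θ̂_{lam'/mu'}` with `F_C`. -/
def thetaConjII (V : CliffordSupermodule.{u, v} k) :
    GammaPi V.forget lam mu →ₗ[k] SymConj V.forget lam mu :=
  thetaConj V.forget lam mu

/-- The Schur superfunctor of type II of shape `lam'/mu'` at `V`: the restriction along `F_C` of the
Schur superfunctor of type I. -/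
def schurConjII (V : CliffordSupermodule.{u, v} k) : Submodule k (SymConj V.forget lam mu) :=
  schurConj V.forget lam mu

variable {M lam mu}

theorem mem_parityShift {ι : Type} (Z : Module.Basis ι k M.carrier) (p : ι → ZMod 2)
    (hZ : ∀ i, Z i ∈ M.grading (p i)) (i : ι) :
    Z i ∈ parityShift M.grading (p i + 1) := by
  have : p i + 1 + 1 = p i := by
    rw [add_assoc]
    exact add_zero (p i)
  rw [parityShift, this]
  exact hZ i

variable {ι : Type} [LinearOrder ι] [Fintype ι]

/-- The element `Z_Π^{(t)} = ⨂_i (ΠZ)^{(t^i)}` of `Γ_Π^{lam/mu}(M)`, where `Z` is a homogeneous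
basis of `M` with parities `p`, so that `ΠZ` is a homogeneous basis of `ΠM` with parities
`p + 1`. -/
def gammaPiMonomial (Z : Module.Basis ι k M.carrier) (p : ι → ZMod 2)
    (hZ : ∀ i, Z i ∈ M.grading (p i)) (t : Tableau lam mu ι) : GammaPi M lam mu :=
  PiTensorProduct.tprod k (fun i =>
    divMonomial (parityShift M.grading) Z (fun j => p j + 1) (mem_parityShift Z p hZ)
      (rowWord t i))

end Superfunctors

end SuperSchur
end

/-!
Expanded in the basis of tensor products of monomials of `S^{lam'/mu'}(M)`, the image under `θ̂` of
the element `Z_Π^{(t)}` has integral coefficients `thetaCoeff`. Up to signs and the orders of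
stabilizers they are the coefficients of `t` under a Young symmetrizer, that is, signed sums over
the row group followed by the column group. Over `ℚ` these factors are invertible, and the Garnir
relations straighten every tableau into costandard ones, by induction on the row and the column
weights. On the other hand, by the rearrangement inequality the integral matrix of the coefficients
of the costandard tableaux is unitriangular, up to signs, for the column weight. Hence the elements
of the costandard tableaux are linearly independent over every field, and the straightening
coefficients are integers, so that straightening holds over every field too. Only the monomial bases
of the symmetric and divided powers need `2 ≠ 0`.
-/

noncomputable section

namespace SuperSchur

section Signs

theorem koszul_comm (a b : ZMod 2) : koszul a b = koszul b a := by
  simp only [koszul, and_comm]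

theorem koszul_zero_left (b : ZMod 2) : koszul 0 b = 1 := by
  simp [koszul]

theorem koszul_zero_right (a : ZMod 2) : koszul a 0 = 1 := by
  simp [koszul]

theorem koszul_add_one_add_one (a b : ZMod 2) :
    koszul (a + 1) (b + 1) = -(koszul a b * (koszul 1 (a + 1) * koszul 1 (b + 1))) := by
  revert a b
  decide

theorem zmod_two_eq_zero_or_one (a : ZMod 2) : a = 0 ∨ a = 1 := by
  revert a
  decide

variable {β : Type*} [Fintype β]

theorem prod_prod_eq_one_of_mul_swap_eq_one {N : Type*} [CommMonoid N] (F : β → β → N)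
    (hdiag : ∀ b, F b b = 1) (hswap : ∀ b c, b ≠ c → F b c * F c b = 1) :
    ∏ b, ∏ c, F b c = 1 := by
  classical
  rw [← Fintype.prod_prod_type' F]
  refine Finset.prod_involution (fun a _ => a.swap) (fun ⟨b, c⟩ _ => ?_) (fun ⟨b, c⟩ _ h => ?_)
    (fun _ _ => Finset.mem_univ _) (fun _ _ => Prod.swap_swap _)
  · obtain rfl | hbc := eq_or_ne b c
    · simp only [Prod.swap_prod_mk, hdiag, mul_one]
    · exact hswap b c hbc
  · rintro heq
    obtain rfl : c = b := congrArg Prod.fst heq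
    exact h (hdiag c)

theorem prod_prod_ite_koszul_mul_self (R : β → β → Prop) [∀ b c, Decidable (R b c)]
    (ε δ : β → β → ZMod 2) :
    (∏ b, ∏ c, if R b c then koszul (ε b c) (δ b c) else 1) *
      (∏ b, ∏ c, if R b c then koszul (ε b c) (δ b c) else 1) = 1 := by
  simp only [← Finset.prod_mul_distrib]
  refine Finset.prod_eq_one fun b _ => Finset.prod_eq_one fun c _ => ?_
  split_ifs
  exacts [koszul_mul_self _ _, one_mul 1]

theorem eq_of_mul_eq_one_of_mul_self {a b : ℤ} (hb : b * b = 1) (hab : a * b = 1) : a = b := by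
  rw [← mul_one a, ← hb, ← mul_assoc, hab, one_mul]

variable {d d' d'' : ℕ}

/-- The sign of passing from the arrangement of homogeneous elements of parities `ε` in the order
of the numbering `f` to their arrangement in the order of the numbering `g`. -/
def relSign (f : β ≃ Fin d) (g : β ≃ Fin d') (ε : β → ZMod 2) : ℤ :=
  ∏ b, ∏ c, if f b < f c ∧ g c < g b then koszul (ε b) (ε c) else 1

theorem relSign_mul_self (f : β ≃ Fin d) (g : β ≃ Fin d') (ε : β → ZMod 2) :
    relSign f g ε * relSign f g ε = 1 :=
  prod_prod_ite_koszul_mul_self _ _ _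

theorem relSign_self (f : β ≃ Fin d) (ε : β → ZMod 2) : relSign f f ε = 1 :=
  Finset.prod_eq_one fun _ _ => Finset.prod_eq_one fun _ _ => if_neg fun h => h.1.asymm h.2

theorem relSign_mul (f : β ≃ Fin d) (g : β ≃ Fin d') (h : β ≃ Fin d'') (ε : β → ZMod 2) :
    relSign f g ε * relSign g h ε = relSign f h ε := by
  refine eq_of_mul_eq_one_of_mul_self (relSign_mul_self f h ε) ?_
  simp only [relSign, ← Finset.prod_mul_distrib]
  refine prod_prod_eq_one_of_mul_swap_eq_one _ (fun b => by simp) fun b c hbc => ?_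
  have hK := koszul_mul_self (ε b) (ε c)
  rw [koszul_comm (ε c) (ε b)]
  rcases lt_or_gt_of_ne (f.injective.ne hbc) with hf | hf <;>
    rcases lt_or_gt_of_ne (g.injective.ne hbc) with hg | hg <;>
    rcases lt_or_gt_of_ne (h.injective.ne hbc) with hh | hh <;>
    simp [hf, hg, hh, hf.not_gt, hg.not_gt, hh.not_gt, hK]

theorem relSign_comm (f : β ≃ Fin d) (g : β ≃ Fin d') (ε : β → ZMod 2) :
    relSign f g ε = relSign g f ε :=
  eq_of_mul_eq_one_of_mul_self (relSign_mul_self g f ε) (by rw [relSign_mul, relSign_self])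

theorem relSign_trans {γ : Type*} [Fintype γ] (w : γ ≃ β) (f : β ≃ Fin d) (g : β ≃ Fin d')
    (ε : β → ZMod 2) : relSign (w.trans f) (w.trans g) (ε ∘ w) = relSign f g ε :=
  Fintype.prod_equiv w _ _ fun _ => Fintype.prod_equiv w _ _ fun _ => rfl

theorem superSign_eq_relSign (f : β ≃ Fin d) (g : β ≃ Fin d') (ε : β → ZMod 2) :
    superSign (ε ∘ f.symm) (g.symm.trans f) = relSign f g ε :=
  Fintype.prod_equiv f.symm _ _ fun _ => Fintype.prod_equiv f.symm _ _ fun _ => by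
    simp only [f.apply_symm_apply]
    rfl

/-- The sign by which the permutation `w` acts on a tensor whose factors are numbered by `f` and
have parities `ε`. -/
def permSign (f : β ≃ Fin d) (ε : β → ZMod 2) (w : Equiv.Perm β) : ℤ :=
  relSign f (w.symm.trans f) ε

theorem permSign_mul_self (f : β ≃ Fin d) (ε : β → ZMod 2) (w : Equiv.Perm β) :
    permSign f ε w * permSign f ε w = 1 :=
  relSign_mul_self _ _ _

theorem permSign_mul (f : β ≃ Fin d) (ε : β → ZMod 2) (w w' : Equiv.Perm β) :
    permSign f ε (w * w') = permSign f ε w * permSign f (ε ∘ w) w' := by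
  have htrans : relSign (w.symm.trans f) (w.symm.trans (w'.symm.trans f)) ε =
      permSign f (ε ∘ w) w' := by
    rw [← relSign_trans w]
    simp only [permSign, ← Equiv.trans_assoc, Equiv.self_trans_symm, Equiv.refl_trans]
  rw [← htrans, permSign, permSign, relSign_mul]
  rfl

theorem permSign_eq_one_of_even (f : β ≃ Fin d) (ε : β → ZMod 2) (w : Equiv.Perm β)
    (h : ∀ b, w b ≠ b → ε b = 0) : permSign f ε w = 1 := by
  have h' : ∀ b, w.symm b ≠ b → ε b = 0 := fun b hb =>
    h b fun hw => hb ((Equiv.symm_apply_eq w).2 hw.symm)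
  refine Finset.prod_eq_one fun b _ => Finset.prod_eq_one fun c _ => ?_
  split_ifs with hbc
  · by_cases hb : w.symm b = b
    · by_cases hc : w.symm c = c
      · simp only [Equiv.trans_apply, hb, hc] at hbc
        exact absurd hbc.1 hbc.2.asymm
      · rw [h' c hc, koszul_zero_right]
    · rw [h' b hb, koszul_zero_left]
  · rfl

/-- The sign acquired by a tensor whose factors are numbered by `f` and have parities `ε`, when the
tensor power of an odd map is applied. -/
def shiftSign (f : β ≃ Fin d) (ε : β → ZMod 2) : ℤ :=
  ∏ b, ∏ c, if f b < f c then koszul 1 (ε b) else 1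

theorem shiftSign_mul_self (f : β ≃ Fin d) (ε : β → ZMod 2) :
    shiftSign f ε * shiftSign f ε = 1 :=
  prod_prod_ite_koszul_mul_self _ _ _

theorem prod_koszul_one_eq_shiftSign (f : β ≃ Fin d) (ε : β → ZMod 2) :
    (∏ s, ∏ t, if s < t then koszul 1 ((ε ∘ f.symm) s) else 1) = shiftSign f ε :=
  Fintype.prod_equiv f.symm _ _ fun _ => Fintype.prod_equiv f.symm _ _ fun _ => by
    simp only [f.apply_symm_apply]
    rfl

theorem shiftSign_comp (f : β ≃ Fin d) (ε : β → ZMod 2) (w : Equiv.Perm β) :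
    shiftSign f (ε ∘ w) = shiftSign (w.symm.trans f) ε :=
  Fintype.prod_equiv w _ _ fun _ => Fintype.prod_equiv w _ _ fun _ => by simp

theorem sign_eq_prod_prod [DecidableEq β] (f : β ≃ Fin d) (w : Equiv.Perm β) :
    (Equiv.Perm.sign w : ℤ) =
      ∏ b, ∏ c, if f b < f c ∧ f (w.symm c) < f (w.symm b) then -1 else 1 := by
  rw [← Equiv.Perm.sign_inv, ← Equiv.Perm.sign_symm_trans_trans w⁻¹ f,
    Equiv.Perm.sign_eq_prod_prod_Ioi]
  push_cast
  refine Fintype.prod_equiv f.symm _ _ fun s => ?_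
  rw [← Finset.prod_filter_mul_prod_filter_not Finset.univ fun c => f (f.symm s) < f c,
    Finset.prod_eq_one (s := Finset.univ.filter fun c => ¬ f (f.symm s) < f c), mul_one]
  · refine Finset.prod_equiv f.symm (by simp) fun t ht => ?_
    have hst : s < t := Finset.mem_Ioi.1 ht
    have hne : f (w.symm (f.symm s)) ≠ f (w.symm (f.symm t)) := by simpa using hst.ne
    rcases hne.lt_or_gt with h | h <;> simp [hst, h, h.not_gt]
  · intro c hc
    rw [if_neg fun h => (Finset.mem_filter.1 hc).2 h.1]

-- The rule of signs for `ΠM` and for `M` differ by the sign character, up to a coboundary.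
theorem permSign_mul_sign [DecidableEq β] (f : β ≃ Fin d) (ε : β → ZMod 2) (w : Equiv.Perm β) :
    permSign f ε w * Equiv.Perm.sign w =
      permSign f (ε + 1) w * (shiftSign f (ε + 1) * shiftSign f ((ε + 1) ∘ w)) := by
  have hsq : (permSign f (ε + 1) w * (shiftSign f (ε + 1) * shiftSign f ((ε + 1) ∘ w))) *
      (permSign f (ε + 1) w * (shiftSign f (ε + 1) * shiftSign f ((ε + 1) ∘ w))) = 1 := by
    rw [mul_mul_mul_comm, permSign_mul_self, mul_mul_mul_comm, shiftSign_mul_self,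
      shiftSign_mul_self, one_mul, one_mul]
  refine eq_of_mul_eq_one_of_mul_self hsq ?_
  rw [shiftSign_comp, sign_eq_prod_prod f w]
  simp only [permSign, relSign, shiftSign, ← Finset.prod_mul_distrib]
  refine prod_prod_eq_one_of_mul_swap_eq_one _ (fun b => by simp) fun b c hbc => ?_
  have hK := koszul_mul_self (ε b) (ε c)
  have hb := koszul_mul_self 1 (ε b + 1)
  have hc := koszul_mul_self 1 (ε c + 1)
  simp only [Pi.add_apply, Pi.one_apply, Equiv.trans_apply, koszul_add_one_add_one]
  rw [koszul_comm (ε c) (ε b)]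
  rcases lt_or_gt_of_ne (f.injective.ne hbc) with h | h <;>
    rcases lt_or_gt_of_ne ((w.symm.trans f).injective.ne hbc) with h' | h' <;>
    simp only [Equiv.trans_apply] at h' <;>
    simp [h, h', h.not_gt, h'.not_gt] <;>
    grind

end Signs

section Lines

variable {β : Type*} {q : ℕ} {n : Fin q → ℕ} (e : (Σ i : Fin q, Fin (n i)) ≃ β)

theorem finSigmaFinEquiv_lt_of_fst_lt {x y : Σ i : Fin q, Fin (n i)} (h : x.1 < y.1) :
    finSigmaFinEquiv x < finSigmaFinEquiv y := by
  rw [Fin.lt_def, finSigmaFinEquiv_apply, finSigmaFinEquiv_apply]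
  have hsum : ∑ i : Fin (x.1 + 1 : ℕ), n (Fin.castLE x.1.2 i) ≤
      ∑ i : Fin (y.1 : ℕ), n (Fin.castLE y.1.2.le i) := by
    exact (Finset.sum_map Finset.univ (Fin.castLEEmb (Nat.succ_le_of_lt h))
      fun i => n (Fin.castLE y.1.2.le i)).symm.trans_le
      (Finset.sum_le_sum_of_subset (Finset.subset_univ _))
  rw [Fin.sum_univ_castSucc] at hsum
  have hx : (x.2 : ℕ) < n (Fin.castLE x.1.2 (Fin.last _)) := x.2.2
  exact (Nat.add_lt_add_left hx _).trans_le (hsum.trans (Nat.le_add_right _ _))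

theorem finSigmaFinEquiv_mk_lt_mk_iff {i : Fin q} {s t : Fin (n i)} :
    finSigmaFinEquiv (⟨i, s⟩ : Σ i : Fin q, Fin (n i)) <
      finSigmaFinEquiv (⟨i, t⟩ : Σ i : Fin q, Fin (n i)) ↔ s < t := by
  rw [Fin.lt_def, finSigmaFinEquiv_apply, finSigmaFinEquiv_apply, Nat.add_lt_add_iff_left,
    Fin.lt_def]

/-- The line of the box `b`, when the boxes are arranged in lines by `e`. -/
def lineOf (b : β) : Fin q := (e.symm b).1

/-- The number of a box in the reading along the lines. -/
def lineRank : β ≃ Fin (∑ i, n i) := e.symm.trans finSigmaFinEquiv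

theorem lineOf_apply (x : Σ i : Fin q, Fin (n i)) : lineOf e (e x) = x.1 :=
  congrArg Sigma.fst (e.symm_apply_apply x)

theorem lineRank_apply (x : Σ i : Fin q, Fin (n i)) : lineRank e (e x) = finSigmaFinEquiv x :=
  congrArg finSigmaFinEquiv (e.symm_apply_apply x)

theorem lineRank_lt_of_lineOf_lt {b c : β} (h : lineOf e b < lineOf e c) :
    lineRank e b < lineRank e c :=
  finSigmaFinEquiv_lt_of_fst_lt h

/-- The group of the permutations of the boxes that preserve every line. -/
def lineGroup : Subgroup (Equiv.Perm β) where
  carrier := {g | ∀ b, lineOf e (g b) = lineOf e b}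
  mul_mem' hg hh b := (hg _).trans (hh b)
  one_mem' _ := rfl
  inv_mem' {g} hg b := (hg _).symm.trans (congrArg (lineOf e) (g.apply_symm_apply b))

theorem mem_lineGroup {g : Equiv.Perm β} :
    g ∈ lineGroup e ↔ ∀ b, lineOf e (g b) = lineOf e b :=
  Iff.rfl

theorem comp_swap_eq_self {α : Type*} [DecidableEq β] (x : β → α) {b c : β} (h : x b = x c) :
    x ∘ Equiv.swap b c = x := by
  rw [Equiv.comp_swap_eq_update, h, Function.update_eq_self, ← h, Function.update_eq_self]

theorem swap_mem_lineGroup [DecidableEq β] {b c : β} (h : lineOf e b = lineOf e c) :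
    Equiv.swap b c ∈ lineGroup e :=
  congrFun (comp_swap_eq_self (lineOf e) h)

/-- The boxes of the `i`-th line, in their order. -/
def lineEquiv (i : Fin q) : Fin (n i) ≃ {b // lineOf e b = i} :=
  (Equiv.sigmaSubtype i).symm.trans (e.subtypeEquiv fun x => by rw [lineOf_apply])

theorem lineEquiv_apply (i : Fin q) (s : Fin (n i)) : (lineEquiv e i s : β) = e ⟨i, s⟩ := rfl

variable {α : Type*}

/-- The word formed by the entries of the `i`-th line of the filling `x`. -/
def lineWord (x : β → α) (i : Fin q) (s : Fin (n i)) : α := x (e ⟨i, s⟩)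

theorem eq_of_lineWord_eq {x y : β → α} (h : lineWord e x = lineWord e y) : x = y := by
  ext b
  obtain ⟨⟨i, s⟩, rfl⟩ := e.surjective b
  exact congrFun (congrFun h i) s

theorem forall_exists_perm_lineWord_iff (x y : β → α) :
    (∀ i, ∃ τ : Equiv.Perm (Fin (n i)), ∀ s, lineWord e y i s = lineWord e x i (τ s)) ↔
      ∃ g ∈ lineGroup e, y = x ∘ g := by
  constructor
  · intro h
    choose τ hτ using h
    refine ⟨(e.symm.trans (Equiv.sigmaCongrRight τ)).trans e, fun b => lineOf_apply e _, ?_⟩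
    ext b
    obtain ⟨⟨i, s⟩, rfl⟩ := e.surjective b
    simpa [lineWord] using hτ i s
  · rintro ⟨g, hg, rfl⟩ i
    refine ⟨(lineEquiv e i).symm.permCongr (g.subtypePerm fun b => by rw [hg b]), fun s => ?_⟩
    rw [lineWord, lineWord, ← lineEquiv_apply, ← lineEquiv_apply, Equiv.permCongr_apply,
      Equiv.symm_symm, Equiv.apply_symm_apply]
    rfl

/-- A filling is line restricted when no odd letter is repeated in any line. -/
def IsLineRestricted (p : α → ZMod 2) (x : β → α) : Prop :=
  ∀ b c, lineOf e b = lineOf e c → x b = x c → p (x b) = 1 → b = c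

variable {ι : Type}

theorem isLineRestricted_iff (p : ι → ZMod 2) (x : β → ι) :
    IsLineRestricted e p x ↔ ∀ i, IsRestricted p (lineWord e x i) := by
  constructor
  · intro h i s t hst hp
    simpa using h (e ⟨i, s⟩) (e ⟨i, t⟩) (by rw [lineOf_apply, lineOf_apply]) hst hp
  · intro h b c hbc hx hp
    obtain ⟨⟨i, s⟩, rfl⟩ := e.surjective b
    obtain ⟨⟨j, t⟩, rfl⟩ := e.surjective c
    obtain rfl : i = j := by simpa only [lineOf_apply] using hbc
    rw [h i s t hx hp]

variable [LinearOrder ι]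

theorem prod_dualCoeff_eq_zero (p : ι → ZMod 2) {x y : β → ι}
    (h : ¬ ∃ g ∈ lineGroup e, y = x ∘ g) :
    ∏ i, dualCoeff p (lineWord e x i) (lineWord e y i) = 0 := by
  rw [← forall_exists_perm_lineWord_iff] at h
  obtain ⟨i, hi⟩ := not_forall.1 h
  exact Finset.prod_eq_zero (Finset.mem_univ i) (if_neg fun hc => hi hc.2)

variable [Fintype β]

/-- The product over all lines of the sorting signs of the words in the lines. -/
def lineSign (p : ι → ZMod 2) (x : β → ι) : ℤ :=
  ∏ b, ∏ c, if (lineOf e b = lineOf e c ∧ lineRank e b < lineRank e c) ∧ x c < x b then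
    koszul (p (x b)) (p (x c)) else 1

theorem lineSign_mul_self (p : ι → ZMod 2) (x : β → ι) : lineSign e p x * lineSign e p x = 1 :=
  prod_prod_ite_koszul_mul_self _ _ _

theorem prod_wordSign (p : ι → ZMod 2) (x : β → ι) :
    ∏ i, wordSign p (lineWord e x i) = lineSign e p x := by
  unfold lineSign wordSign
  rw [← Equiv.prod_comp e, Fintype.prod_sigma]
  refine Finset.prod_congr rfl fun i _ => Finset.prod_congr rfl fun s _ => ?_
  rw [← Equiv.prod_comp e, Fintype.prod_sigma, Finset.prod_eq_single i]
  · simp only [lineOf_apply, lineRank_apply, true_and, finSigmaFinEquiv_mk_lt_mk_iff]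
    rfl
  · intro j _ hj
    refine Finset.prod_eq_one fun t _ => if_neg ?_
    rintro ⟨⟨h, -⟩, -⟩
    exact hj (by simpa only [lineOf_apply] using h.symm)
  · simp

theorem lineSign_comp (p : ι → ZMod 2) (x : β → ι) {g : Equiv.Perm β} (hg : g ∈ lineGroup e) :
    lineSign e p (x ∘ g) = ∏ b, ∏ c,
      if (lineOf e b = lineOf e c ∧ lineRank e (g.symm b) < lineRank e (g.symm c)) ∧ x c < x b then
        koszul (p (x b)) (p (x c)) else 1 :=
  Fintype.prod_equiv g _ _ fun b => Fintype.prod_equiv g _ _ fun c => by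
    simp [hg b, hg c]

theorem permSign_lineRank (p : ι → ZMod 2) {x : β → ι} (hx : IsLineRestricted e p x)
    {g : Equiv.Perm β} (hg : g ∈ lineGroup e) :
    permSign (lineRank e) (p ∘ x) g = lineSign e p x * lineSign e p (x ∘ g) := by
  have hsq : (lineSign e p x * lineSign e p (x ∘ g)) * (lineSign e p x * lineSign e p (x ∘ g)) =
      1 := by
    rw [mul_mul_mul_comm, lineSign_mul_self, lineSign_mul_self, one_mul]
  refine eq_of_mul_eq_one_of_mul_self hsq ?_
  rw [lineSign_comp e p x hg]
  simp only [permSign, relSign, lineSign, ← Finset.prod_mul_distrib]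
  refine prod_prod_eq_one_of_mul_swap_eq_one _ (fun b => by simp) fun b c hbc => ?_
  have hK := koszul_mul_self (p (x b)) (p (x c))
  simp only [Function.comp_apply, Equiv.trans_apply]
  rw [koszul_comm (p (x c)) (p (x b))]
  have hlt : ∀ b c, lineOf e b < lineOf e c →
      lineRank e b < lineRank e c ∧ lineRank e (g.symm b) < lineRank e (g.symm c) := fun b c h =>
    ⟨lineRank_lt_of_lineOf_lt e h, lineRank_lt_of_lineOf_lt e (by
      rwa [← hg (g.symm b), ← hg (g.symm c), g.apply_symm_apply, g.apply_symm_apply])⟩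
  rcases lt_trichotomy (lineOf e b) (lineOf e c) with hl | hl | hl
  · obtain ⟨h, h'⟩ := hlt b c hl
    simp [hl.ne, hl.ne', h, h', h.not_gt, h'.not_gt]
  · by_cases hxe : x b = x c
    · have hp : p (x b) = 0 :=
        (zmod_two_eq_zero_or_one _).resolve_right fun hp => hbc (hx b c hl hxe hp)
      simp [← hxe, hp, koszul_zero_left]
    · rcases lt_or_gt_of_ne ((lineRank e).injective.ne hbc) with h | h <;>
      rcases lt_or_gt_of_ne ((g.symm.trans (lineRank e)).injective.ne hbc) with h' | h' <;>
      rcases lt_or_gt_of_ne hxe with h'' | h'' <;>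
      simp only [Equiv.trans_apply] at h' <;>
      simp [hl, h, h', h'', h.not_gt, h'.not_gt, h''.not_gt, hK]
  · obtain ⟨h, h'⟩ := hlt c b hl
    simp [hl.ne, hl.ne', h, h', h.not_gt, h'.not_gt]

theorem prod_dualCoeff_comp (p : ι → ZMod 2) {x : β → ι} (hx : IsLineRestricted e p x)
    {g : Equiv.Perm β} (hg : g ∈ lineGroup e) :
    ∏ i, dualCoeff p (lineWord e x i) (lineWord e (x ∘ g) i) =
      lineSign e p x * lineSign e p (x ∘ g) := by
  rw [← prod_wordSign, ← prod_wordSign, ← Finset.prod_mul_distrib]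
  refine Finset.prod_congr rfl fun i _ => if_pos ⟨(isLineRestricted_iff e p x).1 hx i, ?_⟩
  exact (forall_exists_perm_lineWord_iff e x _).2 ⟨g, hg, rfl⟩ i

end Lines

section Symmetrizer

variable {β : Type*} [Fintype β] [DecidableEq β] {d : ℕ} (f : β ≃ Fin d)

/-- The sign by which the permutation `w` acts on a tensor whose factors are numbered by `f` and
have parities `ε`, twisted by the sign character. -/
def twistSign (ε : β → ZMod 2) (w : Equiv.Perm β) : ℤ :=
  permSign f ε w * Equiv.Perm.sign w

theorem twistSign_mul (ε : β → ZMod 2) (w w' : Equiv.Perm β) :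
    twistSign f ε (w * w') = twistSign f ε w * twistSign f (ε ∘ w) w' := by
  rw [twistSign, permSign_mul, Equiv.Perm.sign_mul, Units.val_mul, mul_mul_mul_comm]
  rfl

theorem twistSign_mul_self (ε : β → ZMod 2) (w : Equiv.Perm β) :
    twistSign f ε w * twistSign f ε w = 1 := by
  rw [twistSign, mul_mul_mul_comm, permSign_mul_self, Int.units_coe_mul_self, one_mul]

theorem twistSign_eq_one_of_odd {ε : β → ZMod 2} {w : Equiv.Perm β} (hε : ε ∘ w = ε)
    (h : ∀ b, w b ≠ b → ε b = 1) : twistSign f ε w = 1 := by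
  have hshift : (ε + 1) ∘ w = ε + 1 := by rw [Pi.add_comp, hε, Pi.one_comp]
  rw [twistSign, permSign_mul_sign, hshift, shiftSign_mul_self, mul_one]
  refine permSign_eq_one_of_even f _ w fun b hb => ?_
  rw [Pi.add_apply, h b hb]
  rfl

theorem twistSign_swap_of_even {ε : β → ZMod 2} {b c : β} (hbc : b ≠ c) (hb : ε b = 0)
    (hc : ε c = 0) : twistSign f ε (Equiv.swap b c) = -1 := by
  rw [twistSign, Equiv.Perm.sign_swap hbc, permSign_eq_one_of_even, one_mul]
  · rfl
  · intro a ha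
    rcases (Equiv.swap_apply_ne_self_iff.1 ha).2 with rfl | rfl
    exacts [hb, hc]

theorem sum_sum_mul_sign_eq_zero (G H : Subgroup (Equiv.Perm β)) [Fintype G] [Fintype H]
    (F : Equiv.Perm β → ℤ) {r τ τ' : Equiv.Perm β} (hτ : τ ∈ G) (hτ' : τ' ∈ H)
    (hr : τ * r * τ' = r) (hsign : Equiv.Perm.sign τ' = -1) :
    ∑ w : G, ∑ c : H, F (w * (r * c)) * Equiv.Perm.sign (c : Equiv.Perm β) = 0 := by
  rw [← self_eq_neg, ← Finset.sum_neg_distrib]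
  refine Fintype.sum_equiv (Equiv.mulRight ⟨τ, hτ⟩⁻¹) _ _ fun w => ?_
  rw [← Finset.sum_neg_distrib]
  refine Fintype.sum_equiv (Equiv.mulLeft ⟨τ', hτ'⟩⁻¹) _ _ fun c => ?_
  have hr' : τ⁻¹ * (r * τ'⁻¹) = r := by
    rw [inv_mul_eq_iff_eq_mul, mul_inv_eq_iff_eq_mul, hr]
  simp only [Equiv.coe_mulRight, Equiv.coe_mulLeft, Subgroup.coe_mul, Subgroup.coe_inv,
    Equiv.Perm.sign_mul, Equiv.Perm.sign_inv, hsign, Units.val_mul, Units.val_neg, Units.val_one]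
  rw [← mul_assoc r, mul_assoc (w : Equiv.Perm β), ← mul_assoc τ⁻¹, hr']
  ring

variable (R C : Subgroup (Equiv.Perm β)) [Fintype R] [Fintype C] {α : Type*} [DecidableEq α]
  (p : α → ZMod 2)

/-- The coefficient of `s` in the Young symmetrization of the filling `x`, signed along the group
`R` and symmetric along the group `C` for the twisted action. -/
def symCoeff (x s : β → α) : ℤ :=
  ∑ r : R, ∑ c : C, if x ∘ (r * c : Equiv.Perm β) = s then
    twistSign f (p ∘ x) (r * c) * Equiv.Perm.sign (c : Equiv.Perm β) else 0

theorem symCoeff_comp (x s : β → α) {r : Equiv.Perm β} (hr : r ∈ R) :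
    symCoeff f R C p (x ∘ r) s = twistSign f (p ∘ x) r * symCoeff f R C p x s := by
  rw [symCoeff, symCoeff, Finset.mul_sum]
  refine Fintype.sum_equiv (Equiv.mulLeft (⟨r, hr⟩ : R)) _ _ fun r' => ?_
  rw [Finset.mul_sum]
  refine Finset.sum_congr rfl fun c _ => ?_
  rw [Equiv.coe_mulLeft, Subgroup.coe_mul, mul_assoc, twistSign_mul f _ r, mul_ite, mul_zero,
    mul_assoc (twistSign f _ r), ← mul_assoc (twistSign f _ r), twistSign_mul_self, one_mul]
  rfl

theorem symCoeff_eq_zero_of_comp_swap {x : β → α} {b c : β} (hbc : b ≠ c)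
    (hswap : Equiv.swap b c ∈ R) (hx : x b = x c) (hp : p (x b) = 0) (s : β → α) :
    symCoeff f R C p x s = 0 := by
  have h := symCoeff_comp f R C p x s hswap
  have hsign := twistSign_swap_of_even f (ε := p ∘ x) hbc hp ((congrArg p hx).symm.trans hp)
  rw [comp_swap_eq_self x hx, hsign, neg_one_mul] at h
  exact self_eq_neg.1 h

theorem sum_twistSign_mul_symCoeff_eq_zero (X : Set β)
    [Fintype (fixingSubgroup (Equiv.Perm β) Xᶜ)]
    (hX : ∀ r ∈ R, ∃ b ∈ X, ∃ b' ∈ X, b ≠ b' ∧ Equiv.swap (r⁻¹ b) (r⁻¹ b') ∈ C) (x s : β → α) :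
    ∑ w : fixingSubgroup (Equiv.Perm β) Xᶜ,
      twistSign f (p ∘ x) w * symCoeff f R C p (x ∘ (w : Equiv.Perm β)) s = 0 := by
  have hterm : ∀ w v c : Equiv.Perm β, (twistSign f (p ∘ x) w *
      if (x ∘ w) ∘ v = s then twistSign f (p ∘ x ∘ w) v * Equiv.Perm.sign c else 0) =
      (if x ∘ (w * v : Equiv.Perm β) = s then twistSign f (p ∘ x) (w * v) else 0) *
        Equiv.Perm.sign c := fun w v c => by
    rw [mul_ite, mul_zero, ite_mul, zero_mul, twistSign_mul, mul_assoc]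
    rfl
  simp only [symCoeff, Finset.mul_sum, hterm]
  rw [Finset.sum_comm]
  refine Finset.sum_eq_zero fun r _ => ?_
  obtain ⟨b, hb, b', hb', hne, hC⟩ := hX r r.2
  refine sum_sum_mul_sign_eq_zero _ C (fun v => if x ∘ v = s then twistSign f (p ∘ x) v else 0)
    (τ := Equiv.swap b b') ?_ hC ?_
    (Equiv.Perm.sign_swap ((r : Equiv.Perm β)⁻¹.injective.ne hne))
  · rw [mem_fixingSubgroup_iff]
    exact fun c hc => Equiv.swap_apply_of_ne_of_ne (fun h => hc (h ▸ hb)) fun h => hc (h ▸ hb')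
  · rw [Equiv.mul_swap_eq_swap_mul, Equiv.Perm.mul_apply, Equiv.Perm.mul_apply]
    simp [← mul_assoc, Equiv.swap_comm b' b]

end Symmetrizer

section Weights

variable {β : Type*} [Fintype β] {ι : Type} [LinearOrder ι] [Fintype ι]

/-- The number of letters smaller than a letter. -/
def letterRank (a : ι) : ℕ := (Fintype.orderIsoFinOfCardEq ι rfl).symm a

theorem letterRank_strictMono : StrictMono (letterRank : ι → ℕ) :=
  (Fintype.orderIsoFinOfCardEq ι rfl).symm.strictMono

/-- The sum of the ranks of the entries of a filling, weighted by `c`. -/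
def fillingWeight (c : β → ℕ) (x : β → ι) : ℤ := ∑ b, (letterRank (x b) : ℤ) * c b

theorem fillingWeight_comp (c : β → ℕ) (x : β → ι) (w : Equiv.Perm β) :
    fillingWeight c (x ∘ w) = ∑ b, (letterRank (x b) : ℤ) * c (w.symm b) :=
  Fintype.sum_equiv w _ _ fun b => by rw [Equiv.symm_apply_apply]; rfl

theorem fillingWeight_comp_of_comp_eq {c : β → ℕ} (x : β → ι) {w : Equiv.Perm β}
    (hw : ∀ b, c (w b) = c b) : fillingWeight c (x ∘ w) = fillingWeight c x := by
  rw [fillingWeight_comp]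
  refine Finset.sum_congr rfl fun b _ => ?_
  rw [← hw, Equiv.apply_symm_apply]

theorem fillingWeight_comp_sub (c : β → ℕ) (x : β → ι) (w : Equiv.Perm β) (z : ℤ) :
    fillingWeight c (x ∘ w) - fillingWeight c x =
      ∑ b, ((letterRank (x b) : ℤ) - z) * ((c (w.symm b) : ℤ) - c b) := by
  have hc : ∑ b, ((c (w.symm b) : ℤ) - c b) = 0 := by
    rw [Finset.sum_sub_distrib, Equiv.sum_comp w.symm fun b => (c b : ℤ), sub_self]
  simp only [sub_mul, Finset.sum_sub_distrib, ← Finset.mul_sum, hc, mul_zero, sub_zero]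
  simp only [mul_sub, Finset.sum_sub_distrib, ← fillingWeight_comp]
  rfl

theorem fillingWeight_lt_comp_swap [DecidableEq β] {c : β → ℕ} {x : β → ι} {b b' : β}
    (hc : c b < c b') (hx : x b' < x b) :
    fillingWeight c x < fillingWeight c (x ∘ Equiv.swap b b') := by
  have hne : b ≠ b' := fun h => hc.ne (congrArg c h)
  have hrank : (letterRank (x b') : ℤ) < letterRank (x b) :=
    Nat.cast_lt.2 (letterRank_strictMono hx)
  have hc' : (c b : ℤ) < c b' := Nat.cast_lt.2 hc
  rw [← sub_pos, fillingWeight_comp_sub c x _ (letterRank (x b')), Equiv.symm_swap,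
    Finset.sum_eq_single b]
  · rw [Equiv.swap_apply_left]
    exact mul_pos (sub_pos.2 hrank) (sub_pos.2 hc')
  · intro a _ ha
    obtain rfl | ha' := eq_or_ne a b'
    · rw [sub_self, zero_mul]
    · rw [Equiv.swap_apply_of_ne_of_ne ha ha', sub_self, mul_zero]
  · exact fun h => (h (Finset.mem_univ b)).elim

theorem comp_perm_eq_or_fillingWeight_lt_of_monotone {n : ℕ} {x : Fin n → ι}
    (hx : Monotone x) {c : Fin n → ℕ} (hc : StrictMono c) (τ : Equiv.Perm (Fin n)) :
    x ∘ τ = x ∨ fillingWeight c (x ∘ τ) < fillingWeight c x := by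
  have hmono : Monovary (fun s => (letterRank (x s) : ℤ)) fun s => (c s : ℤ) := fun s t hst =>
    Nat.cast_le.2 (letterRank_strictMono.monotone (hx (hc.lt_iff_lt.1 (Nat.cast_lt.1 hst)).le))
  refine or_iff_not_imp_right.2 fun hlt => ?_
  have hτ := not_not.1 (mt (hmono.sum_comp_perm_mul_lt_sum_mul_iff (σ := τ)).2 hlt)
  refine Tuple.unique_monotone (τ := Equiv.refl _) (fun s t hst => ?_) hx
  rcases hst.lt_or_eq with h | rfl
  · exact letterRank_strictMono.le_iff_le.1 (Nat.cast_le.1 (hτ (Nat.cast_lt.2 (hc h))))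
  · exact le_rfl

variable {q : ℕ} {n : Fin q → ℕ} (e : (Σ i : Fin q, Fin (n i)) ≃ β)

theorem fillingWeight_eq_sum_lineWord (c : β → ℕ) (x : β → ι) :
    fillingWeight c x = ∑ i, fillingWeight (lineWord e c i) (lineWord e x i) := by
  rw [fillingWeight, ← Equiv.sum_comp e, Fintype.sum_sigma]
  rfl

theorem comp_eq_or_fillingWeight_lt {x : β → ι} (hx : ∀ i, Monotone (lineWord e x i))
    {c : β → ℕ} (hc : ∀ i, StrictMono (lineWord e c i)) {g : Equiv.Perm β}
    (hg : g ∈ lineGroup e) : x ∘ g = x ∨ fillingWeight c (x ∘ g) < fillingWeight c x := by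
  have hline : ∀ i, lineWord e (x ∘ g) i = lineWord e x i ∨
      fillingWeight (lineWord e c i) (lineWord e (x ∘ g) i) <
        fillingWeight (lineWord e c i) (lineWord e x i) := fun i => by
    obtain ⟨τ, hτ⟩ := (forall_exists_perm_lineWord_iff e x _).2 ⟨g, hg, rfl⟩ i
    rw [show lineWord e (x ∘ g) i = lineWord e x i ∘ τ from funext hτ]
    exact comp_perm_eq_or_fillingWeight_lt_of_monotone (hx i) (hc i) τ
  refine or_iff_not_imp_left.2 fun hne => ?_
  obtain ⟨i, hi⟩ : ∃ i, lineWord e (x ∘ g) i ≠ lineWord e x i := by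
    by_contra! h
    exact hne (eq_of_lineWord_eq e (funext h))
  rw [fillingWeight_eq_sum_lineWord e, fillingWeight_eq_sum_lineWord e c x]
  exact Finset.sum_lt_sum (fun j _ => (hline j).elim (fun h => (congrArg _ h).le) le_of_lt)
    ⟨i, Finset.mem_univ i, (hline i).resolve_left hi⟩

end Weights

section Rearrangement

theorem exists_perm_forall_apply_eq {β γ : Type*} [Finite β] (f : β → γ) (w : Equiv.Perm β)
    {P : β → Prop} (h : ∀ b, f (w b) ≠ f b → P b) :
    ∃ v : Equiv.Perm β, (∀ b, v b ≠ b → P b ∧ P (v b)) ∧ ∀ b, f (v b) = f (w b) := by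
  classical
  have := Fintype.ofFinite β
  have hcard : ∀ k, Fintype.card {b : Subtype P // f (w b) = k} =
      Fintype.card {b : Subtype P // f b = k} := by
    intro k
    have hsum := (Equiv.sum_comp w fun b => if f b = k then 1 else 0).symm
    rw [← Fintype.sum_subtype_add_sum_subtype P, ← Fintype.sum_subtype_add_sum_subtype P,
      Fintype.sum_congr (fun b : {b // ¬ P b} => if f (w b) = k then 1 else 0)
        (fun b => if f b = k then 1 else 0) fun b => by rw [not_not.1 (mt (h b) b.2)]] at hsum
    simp only [Fintype.card_subtype, Finset.card_filter]
    exact (Nat.add_right_cancel hsum).symm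
  obtain ⟨σ, hσ⟩ : ∃ σ : Equiv.Perm (Subtype P), ∀ b, f (σ b) = f (w b) :=
    ⟨Equiv.ofFiberEquiv fun k => Fintype.equivOfCardEq (hcard k),
      Equiv.ofFiberEquiv_map (g := fun b : Subtype P => f b) _⟩
  refine ⟨Equiv.Perm.ofSubtype σ, fun b hb => ?_, fun b => ?_⟩
  · have hP : P b := by
      by_contra hP
      exact hb (Equiv.Perm.ofSubtype_apply_of_not_mem σ hP)
    exact ⟨hP, Equiv.Perm.ofSubtype_apply_of_mem σ hP ▸ (σ ⟨b, hP⟩).2⟩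
  · by_cases hP : P b
    · rw [Equiv.Perm.ofSubtype_apply_of_mem σ hP, hσ]
    · rw [Equiv.Perm.ofSubtype_apply_of_not_mem σ hP, not_not.1 (mt (h b) hP)]

end Rearrangement

section Exchange

variable {β : Type*} [Fintype β] {ι : Type} [LinearOrder ι] [Fintype ι]
  {c : β → ℕ} {x : β → ι} {X : Set β} {i i' : ℕ} {u u' : ι} {w : Equiv.Perm β}

theorem apply_eq_of_fillingWeight_comp_le {z : ι} (hi : i < i')
    (hX : ∀ b ∈ X, c b = i ∧ u ≤ x b ∨ c b = i' ∧ x b ≤ u') (hu' : u' ≤ z) (hu : z ≤ u)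
    (hw : w ∈ fixingSubgroup (Equiv.Perm β) Xᶜ)
    (hle : fillingWeight c (x ∘ w) ≤ fillingWeight c x) {b : β} (hb : c (w.symm b) ≠ c b) :
    x b = z := by
  have hfix : ∀ b ∉ X, w b = b := fun b hb => (mem_fixingSubgroup_iff _).1 hw b hb
  have hmaps : ∀ b ∈ X, w.symm b ∈ X := fun b hb => by
    by_contra hout
    exact hout ((w.apply_symm_apply b).symm.trans (hfix _ hout) ▸ hb)
  have hnonneg : ∀ b ∈ Finset.univ, 0 ≤ ((letterRank (x b) : ℤ) - letterRank z) *
      ((c (w.symm b) : ℤ) - c b) := by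
    intro b _
    by_cases hbX : b ∈ X
    · rcases hX b hbX with ⟨hrow, hx⟩ | ⟨hrow, hx⟩
      · have := letterRank_strictMono.monotone (hu.trans hx)
        refine mul_nonneg (by omega) ?_
        rcases hX _ (hmaps b hbX) with ⟨h, -⟩ | ⟨h, -⟩ <;> omega
      · have := letterRank_strictMono.monotone (hx.trans hu')
        refine mul_nonneg_of_nonpos_of_nonpos (by omega) ?_
        rcases hX _ (hmaps b hbX) with ⟨h, -⟩ | ⟨h, -⟩ <;> omega
    · rw [w.symm_apply_eq.2 (hfix b hbX).symm, sub_self, mul_zero]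
  have hsum := fillingWeight_comp_sub c x w (letterRank z)
  have hzero := (Finset.sum_eq_zero_iff_of_nonneg hnonneg).1
    (le_antisymm (by omega) (Finset.sum_nonneg hnonneg)) b (Finset.mem_univ b)
  rcases mul_eq_zero.1 hzero with h | h
  · exact letterRank_strictMono.injective (by omega)
  · exact absurd (by omega) hb

theorem exists_comp_eq_of_fillingWeight_comp_le [DecidableEq β] {d : ℕ} (f : β ≃ Fin d)
    {p : ι → ZMod 2} (hi : i < i')
    (hX : ∀ b ∈ X, c b = i ∧ u ≤ x b ∨ c b = i' ∧ x b ≤ u') (huu' : u' ≤ u)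
    (hp : u = u' → p u = 1) (hw : w ∈ fixingSubgroup (Equiv.Perm β) Xᶜ)
    (hle : fillingWeight c (x ∘ w) ≤ fillingWeight c x) :
    ∃ r : Equiv.Perm β, (∀ b, c (r b) = c b) ∧ x ∘ w = x ∘ r ∧
      twistSign f (p ∘ x) w = twistSign f (p ∘ x) r := by
  have hmoved {z : ι} (hz' : u' ≤ z) (hz : z ≤ u) {b : β} (hb : c (w.symm b) ≠ c b) : x b = z :=
    apply_eq_of_fillingWeight_comp_le hi hX hz' hz hw hle hb
  by_cases heq : u = u'
  · obtain ⟨v, hv, hcv⟩ := exists_perm_forall_apply_eq c w.symm (P := fun b => x b = u)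
      fun b => hmoved huu' le_rfl
    have hxv : x ∘ v = x := by
      funext b
      by_cases hb : v b = b
      · exact congrArg x hb
      · exact (hv b hb).2.trans (hv b hb).1.symm
    refine ⟨v * w, fun b => ?_, ?_, ?_⟩
    · rw [Equiv.Perm.mul_apply, hcv, Equiv.symm_apply_apply]
    · rw [Equiv.Perm.coe_mul, ← Function.comp_assoc, hxv]
    · have hodd : ∀ b, v b ≠ b → (p ∘ x) b = 1 := fun b hb =>
        (congrArg p (hv b hb).1).trans (hp heq)
      have hεv : (p ∘ x) ∘ v = p ∘ x := by rw [Function.comp_assoc, hxv]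
      rw [twistSign_mul, twistSign_eq_one_of_odd f hεv hodd, one_mul, hεv]
  · refine ⟨w, fun b => ?_, rfl, rfl⟩
    by_contra hb
    have hb' : c (w.symm (w b)) ≠ c (w b) := by rwa [Equiv.symm_apply_apply, ne_comm]
    exact heq ((hmoved huu' le_rfl hb').symm.trans (hmoved le_rfl huu' hb'))

end Exchange

section Diagrams

variable {lam mu : YoungDiagram}

instance : Fintype (Box lam mu) := Fintype.ofEquiv _ (rowBox lam mu)

instance {β : Type*} [Finite β] {q : ℕ} {n : Fin q → ℕ} (e : (Σ i : Fin q, Fin (n i)) ≃ β) :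
    Fintype (lineGroup e) := Fintype.ofFinite _

theorem mem_lineGroup_rowBox {g : Equiv.Perm (Box lam mu)} :
    g ∈ lineGroup (rowBox lam mu) ↔ ∀ b, (g b).1.1 = b.1.1 := by
  simp only [mem_lineGroup, Fin.ext_iff]
  rfl

theorem mem_lineGroup_colBox {g : Equiv.Perm (Box lam mu)} :
    g ∈ lineGroup (colBox lam mu) ↔ ∀ b, (g b).1.2 = b.1.2 := by
  simp only [mem_lineGroup, Fin.ext_iff]
  rfl

theorem Box.mem_Ico_rowLen (b : Box lam mu) :
    b.1.2 ∈ Finset.Ico (mu.rowLen b.1.1) (lam.rowLen b.1.1) :=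
  Finset.mem_Ico.2 ⟨not_lt.1 fun h => b.2.2 (YoungDiagram.mem_iff_lt_rowLen.2 h),
    YoungDiagram.mem_iff_lt_rowLen.1 b.2.1⟩

theorem exists_box_of_mem_Ico_rowLen {i j : ℕ}
    (h : j ∈ Finset.Ico (mu.rowLen i) (lam.rowLen i)) : ∃ b : Box lam mu, b.1 = (i, j) := by
  rw [Finset.mem_Ico] at h
  exact ⟨⟨(i, j), YoungDiagram.mem_iff_lt_rowLen.2 h.2,
    fun hmem => h.1.not_gt (YoungDiagram.mem_iff_lt_rowLen.1 hmem)⟩, rfl⟩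

variable {ι : Type} [LinearOrder ι] {p : ι → ZMod 2} {x : Tableau lam mu ι}

theorem IsRowCostandard.apply_le (hx : IsRowCostandard p x) {b b' : Box lam mu}
    (hrow : b.1.1 = b'.1.1) (hcol : b.1.2 ≤ b'.1.2) : x b ≤ x b' := by
  rcases hcol.lt_or_eq with hlt | heq
  · exact (hx b b' hrow hlt).1
  · rw [show b = b' from Subtype.ext (Prod.ext hrow heq)]

/-- The Garnir set of two boxes of a column: the part of the row of the first box to its right,
and the part of the row of the second box to its left, both boxes included. -/
def garnirSet (a a' : Box lam mu) : Finset (Box lam mu) :=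
  {b | b.1.1 = a.1.1 ∧ a.1.2 ≤ b.1.2 ∨ b.1.1 = a'.1.1 ∧ b.1.2 ≤ a'.1.2}

theorem mem_garnirSet {a a' b : Box lam mu} : b ∈ garnirSet a a' ↔
    b.1.1 = a.1.1 ∧ a.1.2 ≤ b.1.2 ∨ b.1.1 = a'.1.1 ∧ b.1.2 ≤ a'.1.2 := by
  simp only [garnirSet, Finset.mem_filter, Finset.mem_univ, true_and]

variable {a a' : Box lam mu}

theorem card_Ico_lt_card_garnirSet (hrow : a.1.1 < a'.1.1) (hcol : a.1.2 = a'.1.2) :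
    (Finset.Ico (mu.rowLen a'.1.1) (lam.rowLen a.1.1)).card < (garnirSet a a').card := by
  have ha := Finset.mem_Ico.1 a.mem_Ico_rowLen
  have ha' := Finset.mem_Ico.1 a'.mem_Ico_rowLen
  have hsurj : Set.SurjOn (fun b : Box lam mu => b.1.2) ((garnirSet a a').erase a' : Finset _)
      (Finset.Ico (mu.rowLen a'.1.1) (lam.rowLen a.1.1)) := by
    intro j hj
    rw [Finset.mem_coe, Finset.mem_Ico] at hj
    rcases lt_or_ge j a.1.2 with hlt | hge
    · obtain ⟨b, hb⟩ := exists_box_of_mem_Ico_rowLen (lam := lam) (mu := mu) (i := a'.1.1) (j := j)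
        (Finset.mem_Ico.2 ⟨hj.1, by omega⟩)
      refine ⟨b, Finset.mem_erase.2 ⟨?_, mem_garnirSet.2 (Or.inr ?_)⟩, by simp only [hb]⟩
      · rintro rfl
        exact (hcol ▸ hlt).ne (congrArg Prod.snd hb).symm
      · rw [hb]
        exact ⟨rfl, (hcol ▸ hlt).le⟩
    · have hmu := mu.rowLen_anti _ _ hrow.le
      obtain ⟨b, hb⟩ := exists_box_of_mem_Ico_rowLen (lam := lam) (mu := mu) (i := a.1.1) (j := j)
        (Finset.mem_Ico.2 ⟨by omega, hj.2⟩)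
      refine ⟨b, Finset.mem_erase.2 ⟨?_, mem_garnirSet.2 (Or.inl ?_)⟩, by simp only [hb]⟩
      · rintro rfl
        exact hrow.ne' (congrArg Prod.fst hb :)
      · rw [hb]
        exact ⟨rfl, hge⟩
  exact (Finset.card_le_card_of_surjOn _ hsurj).trans_lt
    (Finset.card_erase_lt_of_mem (mem_garnirSet.2 (Or.inr ⟨rfl, le_rfl⟩)))

theorem exists_garnirSet_same_column (hrow : a.1.1 < a'.1.1) (hcol : a.1.2 = a'.1.2)
    {r : Equiv.Perm (Box lam mu)} (hr : r ∈ lineGroup (rowBox lam mu)) :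
    ∃ b ∈ garnirSet a a', ∃ b' ∈ garnirSet a a', b ≠ b' ∧ (r⁻¹ b).1.2 = (r⁻¹ b').1.2 := by
  have hlam := lam.rowLen_anti _ _ hrow.le
  have hmu := mu.rowLen_anti _ _ hrow.le
  refine Finset.exists_ne_map_eq_of_card_lt_of_maps_to (card_Ico_lt_card_garnirSet hrow hcol)
    fun b hb => ?_
  have hmem := Finset.mem_Ico.1 (r⁻¹ b).mem_Ico_rowLen
  rw [mem_lineGroup_rowBox.1 (inv_mem hr)] at hmem
  rw [Finset.mem_coe, Finset.mem_Ico]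
  rcases mem_garnirSet.1 hb with ⟨h, -⟩ | ⟨h, -⟩ <;> rw [h] at hmem <;> omega

end Diagrams

section Straightening

variable {lam mu : YoungDiagram} {ι : Type} [LinearOrder ι] (p : ι → ZMod 2)
  {x : Tableau lam mu ι}

/-- The coefficients of the Young symmetrization of a tableau, as a rational vector. -/
def symVec (x : Tableau lam mu ι) : Tableau lam mu ι → ℚ := fun s =>
  symCoeff (lineRank (rowBox lam mu)) (lineGroup (rowBox lam mu)) (lineGroup (colBox lam mu)) p x s

theorem symVec_eq_smul_comp (x : Tableau lam mu ι) {r : Equiv.Perm (Box lam mu)}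
    (hr : r ∈ lineGroup (rowBox lam mu)) :
    symVec p x = (twistSign (lineRank (rowBox lam mu)) (p ∘ x) r : ℚ) • symVec p (x ∘ r) := by
  funext s
  rw [Pi.smul_apply, symVec, symVec, symCoeff_comp _ _ _ p x s hr, smul_eq_mul, Int.cast_mul,
    ← mul_assoc, ← Int.cast_mul, twistSign_mul_self, Int.cast_one, one_mul]

theorem symVec_eq_zero {b b' : Box lam mu} (hne : b ≠ b') (hrow : b.1.1 = b'.1.1)
    (hx : x b = x b') (hp : p (x b) = 0) : symVec p x = 0 := by
  funext s
  rw [symVec, symCoeff_eq_zero_of_comp_swap _ _ _ p hne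
    (swap_mem_lineGroup (rowBox lam mu) (Fin.ext hrow)) hx hp, Int.cast_zero, Pi.zero_apply]

theorem sum_twistSign_smul_symVec_eq_zero {a a' : Box lam mu} (hrow : a.1.1 < a'.1.1)
    (hcol : a.1.2 = a'.1.2)
    [Fintype (fixingSubgroup (Equiv.Perm (Box lam mu)) (garnirSet a a' : Set (Box lam mu))ᶜ)]
    (x : Tableau lam mu ι) :
    ∑ w : fixingSubgroup (Equiv.Perm (Box lam mu)) (garnirSet a a' : Set (Box lam mu))ᶜ,
      (twistSign (lineRank (rowBox lam mu)) (p ∘ x) w : ℚ) •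
        symVec p (x ∘ (w : Equiv.Perm (Box lam mu))) = 0 := by
  funext s
  simp only [Finset.sum_apply, Pi.smul_apply, symVec, smul_eq_mul, Pi.zero_apply]
  exact_mod_cast sum_twistSign_mul_symCoeff_eq_zero (lineRank (rowBox lam mu)) _ _ p _
    (fun r hr => by
      obtain ⟨b, hb, b', hb', hne, heq⟩ := exists_garnirSet_same_column hrow hcol hr
      exact ⟨b, hb, b', hb', hne, swap_mem_lineGroup (colBox lam mu) (Fin.ext heq)⟩) x s

theorem mem_of_sum_eq_zero_of_forall_eq_or_mem {V κ : Type*} [AddCommGroup V] [Module ℚ V]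
    [Fintype κ] {U : Submodule ℚ V} {y : V} {v : κ → V} (hv : ∀ j, v j = y ∨ v j ∈ U)
    (j₀ : κ) (hj₀ : v j₀ = y) (hsum : ∑ j, v j = 0) : y ∈ U := by
  classical
  rw [← Finset.sum_filter_add_sum_filter_not _ fun j => v j = y,
    Finset.sum_congr rfl fun j hj => (Finset.mem_filter.1 hj).2, Finset.sum_const,
    ← Nat.cast_smul_eq_nsmul ℚ] at hsum
  have hcard : ((Finset.univ.filter fun j => v j = y).card : ℚ) ≠ 0 :=
    Nat.cast_ne_zero.2 (Finset.card_ne_zero.2 ⟨j₀, by simpa using hj₀⟩)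
  rw [← Submodule.smul_mem_iff U hcard, eq_neg_of_add_eq_zero_left hsum]
  exact U.neg_mem (U.sum_mem fun j hj => (hv j).resolve_left (Finset.mem_filter.1 hj).2)

variable [Fintype ι] {p} {U : Submodule ℚ (Tableau lam mu ι → ℚ)}

/-- The sum of the ranks of the entries of a tableau, weighted by the row numbers. -/
def rowWeight (x : Tableau lam mu ι) : ℤ := fillingWeight (fun b : Box lam mu => b.1.1) x

/-- The sum of the ranks of the entries of a tableau, weighted by the column numbers. -/
def colWeight (x : Tableau lam mu ι) : ℤ := fillingWeight (fun b : Box lam mu => b.1.2) x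

theorem symVec_mem_of_not_isRowCostandard (hx : ¬ IsRowCostandard p x)
    (hU : ∀ y : Tableau lam mu ι, rowWeight y = rowWeight x → colWeight x < colWeight y →
      symVec p y ∈ U) : symVec p x ∈ U := by
  unfold IsRowCostandard at hx
  push Not at hx
  obtain ⟨b, b', hrow, hcol, hviol⟩ := hx
  have hne : b ≠ b' := fun h => hcol.ne (congrArg (fun b : Box lam mu => b.1.2) h)
  rcases lt_or_ge (x b') (x b) with hlt | hle
  · have hmem := swap_mem_lineGroup (rowBox lam mu) (Fin.ext hrow)
    rw [symVec_eq_smul_comp p x hmem]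
    exact U.smul_mem _ (hU _ (fillingWeight_comp_of_comp_eq x (mem_lineGroup_rowBox.1 hmem))
      (fillingWeight_lt_comp_swap hcol hlt))
  · obtain ⟨hxb, hpx⟩ := hviol hle
    rw [symVec_eq_zero p hne hrow hxb ((zmod_two_eq_zero_or_one _).resolve_right hpx)]
    exact U.zero_mem

theorem symVec_mem_of_not_isColCostandard (hrow : IsRowCostandard p x)
    (hcol : ¬ IsColCostandard p x)
    (hU : ∀ y : Tableau lam mu ι, rowWeight x < rowWeight y → symVec p y ∈ U) :
    symVec p x ∈ U := by
  unfold IsColCostandard at hcol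
  push Not at hcol
  obtain ⟨a, a', hcaa', hraa', hviol⟩ := hcol
  have hle : x a' ≤ x a := (le_total _ _).elim (fun h => (hviol h).1.ge) id
  have hodd : x a = x a' → p (x a) = 1 := fun h =>
    (zmod_two_eq_zero_or_one _).resolve_left (hviol h.le).2
  have hX : ∀ b ∈ (garnirSet a a' : Set (Box lam mu)),
      b.1.1 = a.1.1 ∧ x a ≤ x b ∨ b.1.1 = a'.1.1 ∧ x b ≤ x a' := fun b hb =>
    (mem_garnirSet.1 hb).imp (fun h => ⟨h.1, hrow.apply_le h.1.symm h.2⟩)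
      fun h => ⟨h.1, hrow.apply_le h.1 h.2⟩
  have := Fintype.ofFinite
    (fixingSubgroup (Equiv.Perm (Box lam mu)) (garnirSet a a' : Set (Box lam mu))ᶜ)
  refine mem_of_sum_eq_zero_of_forall_eq_or_mem (fun w => ?_) 1 ?_
    (sum_twistSign_smul_symVec_eq_zero p hraa' hcaa' x)
  · rcases lt_or_ge (rowWeight x) (rowWeight (x ∘ (w : Equiv.Perm (Box lam mu)))) with hlt | hge
    · exact Or.inr (U.smul_mem _ (hU _ hlt))
    · obtain ⟨r, hr, hxr, hsign⟩ := exists_comp_eq_of_fillingWeight_comp_le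
        (lineRank (rowBox lam mu)) hraa' hX hle hodd w.2 hge
      rw [hxr, hsign, ← symVec_eq_smul_comp p x (mem_lineGroup_rowBox.2 hr)]
      exact Or.inl rfl
  · exact (symVec_eq_smul_comp p x (one_mem _)).symm

end Straightening

section CostandardSpan

variable {lam mu : YoungDiagram} {ι : Type} [LinearOrder ι] [Finite ι] {p : ι → ZMod 2}

theorem symVec_mem_span_isCostandard (x : Tableau lam mu ι) :
    symVec p x ∈ Submodule.span ℚ
      (Set.range fun t : {t : Tableau lam mu ι // IsCostandard p t} => symVec p t.1) := by
  cases nonempty_fintype ι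
  have hwf := Finite.wellFounded_of_trans_of_irrefl
    ((fun t : Tableau lam mu ι => toLex (rowWeight t, colWeight t)) ⁻¹'o (· > ·))
  induction x using hwf.induction with
  | _ x ih =>
  by_cases hrow : IsRowCostandard p x
  · by_cases hcol : IsColCostandard p x
    · exact Submodule.subset_span ⟨⟨x, hrow, hcol⟩, rfl⟩
    · exact symVec_mem_of_not_isColCostandard hrow hcol fun y hlt =>
        ih y (Prod.Lex.toLex_lt_toLex.2 (Or.inl hlt))
  · exact symVec_mem_of_not_isRowCostandard hrow fun y heq hlt =>
      ih y (Prod.Lex.toLex_lt_toLex.2 (Or.inr ⟨heq.symm, hlt⟩))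

end CostandardSpan

section Coefficients

variable {β : Type*} {ι : Type} [LinearOrder ι]
  {q q' : ℕ} {n : Fin q → ℕ} {n' : Fin q' → ℕ}
  (e : (Σ i : Fin q, Fin (n i)) ≃ β) (e' : (Σ i : Fin q', Fin (n' i)) ≃ β)
  (p : ι → ZMod 2)

theorem comp_eq_self_of_monotone_lineWord {x : β → ι} {g : Equiv.Perm β} (hg : g ∈ lineGroup e)
    (hx : ∀ i, Monotone (lineWord e x i)) (hxg : ∀ i, Monotone (lineWord e (x ∘ g) i)) :
    x ∘ g = x := by
  refine eq_of_lineWord_eq e (funext fun i => ?_)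
  obtain ⟨τ, hτ⟩ := (forall_exists_perm_lineWord_iff e x (x ∘ g)).2 ⟨g, hg, rfl⟩ i
  have hcomp : lineWord e (x ∘ g) i = lineWord e x i ∘ τ := funext hτ
  rw [hcomp]
  exact Tuple.unique_monotone (τ := Equiv.refl _) (hcomp ▸ hxg i) (hx i)

theorem eq_comp_and_eq_comp_of_mul_ne_zero {x y s : β → ι} {a b : ℤ}
    (h : ((∏ i, dualCoeff (p + 1) (lineWord e x i) (lineWord e y i)) * a) *
      (b * ∏ j, dualCoeff p (lineWord e' s j) (lineWord e' y j)) ≠ 0) :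
    (∃ g ∈ lineGroup e, y = x ∘ g) ∧ ∃ g ∈ lineGroup e', y = s ∘ g :=
  ⟨by_contra fun hy => h (by rw [prod_dualCoeff_eq_zero e _ hy, zero_mul, zero_mul]),
    by_contra fun hy => h (by rw [prod_dualCoeff_eq_zero e' _ hy, mul_zero, mul_zero])⟩

variable [Fintype β]

/-- The order of the group of the permutations within the lines that preserve a filling. -/
def stabilizerCard (x : β → ι) : ℕ :=
  (Finset.univ.filter fun g : lineGroup e => x ∘ (g : Equiv.Perm β) = x).card

theorem stabilizerCard_pos (x : β → ι) : 0 < stabilizerCard e x :=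
  Finset.card_pos.2 ⟨1, Finset.mem_filter.2 ⟨Finset.mem_univ _, rfl⟩⟩

theorem card_filter_comp_eq_comp (x : β → ι) {g : Equiv.Perm β} (hg : g ∈ lineGroup e) :
    (Finset.univ.filter fun r : lineGroup e => x ∘ (r : Equiv.Perm β) = x ∘ g).card =
      stabilizerCard e x := by
  refine (Finset.card_equiv (Equiv.mulRight (⟨g, hg⟩ : lineGroup e)) fun r => ?_).symm
  simp only [Finset.mem_filter, Finset.mem_univ, true_and, Equiv.coe_mulRight, Subgroup.coe_mul,
    Equiv.Perm.coe_mul, ← Function.comp_assoc]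
  exact g.surjective.injective_comp_right.eq_iff.symm

theorem sum_ite_comp_eq {F : Equiv.Perm β → ℤ} {G : (β → ι) → ℤ} {x : β → ι}
    (hF : ∀ g ∈ lineGroup e, F g = G (x ∘ g)) (y : β → ι)
    (hG : (¬ ∃ g ∈ lineGroup e, y = x ∘ g) → G y = 0) :
    ∑ r : lineGroup e, (if x ∘ (r : Equiv.Perm β) = y then F r else 0) =
      stabilizerCard e x * G y := by
  have hterm : ∀ r : lineGroup e, (if x ∘ (r : Equiv.Perm β) = y then F r else 0) =
      if x ∘ (r : Equiv.Perm β) = y then G y else 0 := fun r => by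
    split_ifs with h
    · rw [hF r r.2, h]
    · rfl
  simp only [hterm, ← Finset.sum_filter, Finset.sum_const, nsmul_eq_mul]
  by_cases hy : ∃ g ∈ lineGroup e, y = x ∘ g
  · obtain ⟨g, hg, rfl⟩ := hy
    rw [card_filter_comp_eq_comp e x hg]
  · rw [hG hy, mul_zero, mul_zero]

theorem permSign_eq_relSign_mul {d d' : ℕ} (f : β ≃ Fin d) (f' : β ≃ Fin d') (ε : β → ZMod 2)
    (w : Equiv.Perm β) :
    permSign f ε w = relSign f f' ε * permSign f' ε w * relSign f f' (ε ∘ w) := by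
  have htrans : relSign f f' (ε ∘ w) = relSign (w.symm.trans f') (w.symm.trans f) ε := by
    rw [relSign_comm f f', ← relSign_trans w (w.symm.trans f') (w.symm.trans f),
      ← Equiv.trans_assoc, ← Equiv.trans_assoc, Equiv.self_trans_symm, Equiv.refl_trans,
      Equiv.refl_trans]
  rw [htrans, permSign, permSign, relSign_mul, relSign_mul]

theorem permSign_comp_inv {d : ℕ} (f : β ≃ Fin d) (ε : β → ZMod 2) (w : Equiv.Perm β) :
    permSign f (ε ∘ w) w⁻¹ = permSign f ε w := by
  refine eq_of_mul_eq_one_of_mul_self (permSign_mul_self f ε w) ?_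
  rw [mul_comm, ← permSign_mul, mul_inv_cancel]
  exact permSign_eq_one_of_even f ε 1 fun b hb => absurd rfl hb

theorem sum_permSign (x y : β → ι) (hy : IsLineRestricted e' p y) :
    ∑ c : lineGroup e', (if x ∘ (c : Equiv.Perm β) = y then
        permSign (lineRank e) (p ∘ x) c else 0) =
      stabilizerCard e' y * relSign (lineRank e) (lineRank e') (p ∘ y) *
        (relSign (lineRank e) (lineRank e') (p ∘ x) *
          ∏ j, dualCoeff p (lineWord e' y j) (lineWord e' x j)) := by
  have hinv : ∑ c : lineGroup e', (if x ∘ (c : Equiv.Perm β) = y then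
        permSign (lineRank e) (p ∘ x) c else 0) =
      ∑ c : lineGroup e', if y ∘ (c : Equiv.Perm β) = x then
        permSign (lineRank e) (p ∘ y) c else 0 :=
    Fintype.sum_equiv (Equiv.inv _) _ _ fun c => by
      have hiff : x ∘ (c : Equiv.Perm β) = y ↔ y ∘ ((c⁻¹ : lineGroup e') : Equiv.Perm β) = x :=
        (Equiv.eq_comp_symm (c : Equiv.Perm β) x y).symm.trans eq_comm
      refine ite_congr (propext hiff) (fun h => ?_) fun _ => rfl
      rw [← h]
      exact permSign_comp_inv (lineRank e) (p ∘ y) (c : Equiv.Perm β)⁻¹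
  rw [hinv, sum_ite_comp_eq e' (G := fun z => relSign (lineRank e) (lineRank e') (p ∘ y) *
    (relSign (lineRank e) (lineRank e') (p ∘ z) *
      ∏ j, dualCoeff p (lineWord e' y j) (lineWord e' z j))) (fun g hg => ?_) x fun h => ?_,
    mul_assoc]
  · rw [permSign_eq_relSign_mul _ (lineRank e'), permSign_lineRank e' p hy hg,
      prod_dualCoeff_comp e' p hy hg, mul_assoc, mul_comm (relSign _ _ (p ∘ (y ∘ g)))]
    rfl
  · rw [prod_dualCoeff_eq_zero e' p h, mul_zero, mul_zero]

variable [DecidableEq β]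

theorem sum_twistSign (x y : β → ι) (hx : IsLineRestricted e (p + 1) x) :
    ∑ r : lineGroup e, (if x ∘ (r : Equiv.Perm β) = y then
        twistSign (lineRank e) (p ∘ x) r else 0) =
      stabilizerCard e x * shiftSign (lineRank e) ((p + 1) ∘ x) *
        ((∏ i, dualCoeff (p + 1) (lineWord e x i) (lineWord e y i)) *
          shiftSign (lineRank e) ((p + 1) ∘ y)) := by
  rw [sum_ite_comp_eq e (G := fun z => shiftSign (lineRank e) ((p + 1) ∘ x) *
    ((∏ i, dualCoeff (p + 1) (lineWord e x i) (lineWord e z i)) *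
      shiftSign (lineRank e) ((p + 1) ∘ z))) (fun g hg => ?_) y fun h => ?_, mul_assoc]
  · rw [twistSign, permSign_mul_sign, prod_dualCoeff_comp e _ hx hg, ← permSign_lineRank e _ hx hg,
      mul_left_comm]
    rfl
  · rw [prod_dualCoeff_eq_zero e _ h, zero_mul, mul_zero]

variable [Fintype ι]

theorem symCoeff_eq_sum_mul {d : ℕ} (f : β ≃ Fin d) (x s : β → ι) :
    symCoeff f (lineGroup e) (lineGroup e') p x s = ∑ y : β → ι,
      (∑ r : lineGroup e, if x ∘ (r : Equiv.Perm β) = y then twistSign f (p ∘ x) r else 0) *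
        ∑ c : lineGroup e', if y ∘ (c : Equiv.Perm β) = s then permSign f (p ∘ y) c else 0 := by
  simp only [Finset.sum_mul, ite_mul, zero_mul]
  rw [Finset.sum_comm]
  refine Finset.sum_congr rfl fun r _ => ?_
  rw [Finset.sum_ite_eq, if_pos (Finset.mem_univ _), Finset.mul_sum]
  refine Finset.sum_congr rfl fun c _ => ?_
  have hsign : twistSign f (p ∘ x) (r * c) * Equiv.Perm.sign (c : Equiv.Perm β) =
      twistSign f (p ∘ x) r * permSign f (p ∘ x ∘ (r : Equiv.Perm β)) c := by
    rw [twistSign_mul, mul_assoc, twistSign.eq_def f _ (c : Equiv.Perm β), mul_assoc,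
      ← Units.val_mul, Int.units_mul_self, Units.val_one, mul_one]
    rfl
  rw [mul_ite, mul_zero, hsign]
  rfl

/-- The coefficient of the monomial of the words of `s` in the lines of `e'` in the image under
`θ̂` of the divided power monomial of the words of `x` in the lines of `e`. -/
def thetaCoeff (x s : β → ι) : ℤ :=
  ∑ y : β → ι, ((∏ i, dualCoeff (p + 1) (lineWord e x i) (lineWord e y i)) *
      shiftSign (lineRank e) ((p + 1) ∘ y)) *
    (relSign (lineRank e) (lineRank e') (p ∘ y) *
      ∏ j, dualCoeff p (lineWord e' s j) (lineWord e' y j))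

theorem symCoeff_eq_mul_thetaCoeff {x s : β → ι} (hx : IsLineRestricted e (p + 1) x)
    (hs : IsLineRestricted e' p s) :
    symCoeff (lineRank e) (lineGroup e) (lineGroup e') p x s =
      (stabilizerCard e x * shiftSign (lineRank e) ((p + 1) ∘ x)) *
        (stabilizerCard e' s * relSign (lineRank e) (lineRank e') (p ∘ s)) *
        thetaCoeff e e' p x s := by
  rw [symCoeff_eq_sum_mul, thetaCoeff, Finset.mul_sum]
  refine Finset.sum_congr rfl fun y _ => ?_
  rw [sum_twistSign e p x y hx, sum_permSign e e' p y s hs, mul_mul_mul_comm]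

end Coefficients

section Triangularity

theorem mem_of_forall_sum_mem_of_triangular {τ R K W : Type*} [Fintype τ] [Ring R]
    [AddCommGroup K] [Module R K] [Preorder W] {S : Submodule R K} {A : τ → τ → R} {wt : τ → W}
    (hdiag : ∀ t, IsUnit (A t t)) (hA : ∀ t s, A t s ≠ 0 → s = t ∨ wt s < wt t) {c : τ → K}
    (hc : ∀ s, ∑ t, A t s • c t ∈ S) (s : τ) : c s ∈ S := by
  classical
  have hwf := Finite.wellFounded_of_trans_of_irrefl (wt ⁻¹'o (· > ·))
  induction s using hwf.induction with
  | _ s ih =>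
  have hs := hc s
  rw [← Finset.add_sum_erase _ _ (Finset.mem_univ s)] at hs
  have hrest : ∑ t ∈ Finset.univ.erase s, A t s • c t ∈ S := by
    refine S.sum_mem fun t ht => ?_
    by_cases h0 : A t s = 0
    · rw [h0, zero_smul]
      exact S.zero_mem
    · exact S.smul_mem _ (ih t ((hA t s h0).resolve_left (Finset.ne_of_mem_erase ht).symm))
  obtain ⟨a, ha⟩ := hdiag s
  rw [← ha] at hs
  exact (S.smul_mem_iff_of_isUnit a.isUnit).1 ((S.add_mem_iff_left hrest).1 hs)

variable {lam mu : YoungDiagram} {ι : Type} [LinearOrder ι] {p : ι → ZMod 2}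
  {t s : Tableau lam mu ι}

theorem strictMono_lineWord_rowBox_col (i : Fin (lam.colLen 0)) :
    StrictMono (lineWord (rowBox lam mu) (fun b => b.1.2) i) :=
  fun _ _ h => Nat.add_lt_add_left h _

theorem IsCostandard.monotone_row (ht : IsCostandard p t) (i : Fin (lam.colLen 0)) :
    Monotone (lineWord (rowBox lam mu) t i) :=
  monotone_iff_forall_lt.2 fun r s h =>
    (ht.1 (rowBox lam mu ⟨i, r⟩) (rowBox lam mu ⟨i, s⟩) rfl (Nat.add_lt_add_left h _)).1

theorem IsCostandard.monotone_col (ht : IsCostandard p t) (j : Fin (lam.rowLen 0)) :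
    Monotone (lineWord (colBox lam mu) t j) :=
  monotone_iff_forall_lt.2 fun r s h =>
    (ht.2 (colBox lam mu ⟨j, r⟩) (colBox lam mu ⟨j, s⟩) rfl (Nat.add_lt_add_left h _)).1

theorem IsCostandard.isLineRestricted_row (ht : IsCostandard p t) :
    IsLineRestricted (rowBox lam mu) (p + 1) t := by
  intro b b' hline hx hodd
  have hrow : b.1.1 = b'.1.1 := congrArg Fin.val hline
  have hp : p (t b) ≠ 1 := fun h => by simp [h, CharTwo.add_self_eq_zero] at hodd
  rcases lt_trichotomy b.1.2 b'.1.2 with h | h | h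
  · exact absurd ((ht.1 b b' hrow h).2 hx) hp
  · exact Subtype.ext (Prod.ext hrow h)
  · exact absurd ((ht.1 b' b hrow.symm h).2 hx.symm) (hx ▸ hp)

theorem IsCostandard.isLineRestricted_col (ht : IsCostandard p t) :
    IsLineRestricted (colBox lam mu) p t := by
  intro b b' hline hx hodd
  have hcol : b.1.2 = b'.1.2 := congrArg Fin.val hline
  have hp : p (t b) ≠ 0 := hodd ▸ one_ne_zero
  rcases lt_trichotomy b.1.1 b'.1.1 with h | h | h
  · exact absurd ((ht.2 b b' hcol h).2 hx) hp
  · exact Subtype.ext (Prod.ext h hcol)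
  · exact absurd ((ht.2 b' b hcol.symm h).2 hx.symm) (hx ▸ hp)

variable [Fintype ι]

theorem IsCostandard.eq_or_colWeight_lt (ht : IsCostandard p t) (hs : IsCostandard p s)
    {y : Tableau lam mu ι} (hrow : ∃ g ∈ lineGroup (rowBox lam mu), y = t ∘ g)
    (hcol : ∃ g ∈ lineGroup (colBox lam mu), y = s ∘ g) :
    y = t ∧ s = t ∨ colWeight s < colWeight t := by
  obtain ⟨r, hr, rfl⟩ := hrow
  obtain ⟨c, hc, hrc⟩ := hcol
  rcases comp_eq_or_fillingWeight_lt (rowBox lam mu) ht.monotone_row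
    strictMono_lineWord_rowBox_col hr with heq | hlt
  · rw [heq] at hrc ⊢
    refine Or.inl ⟨rfl, ?_⟩
    rw [hrc, comp_eq_self_of_monotone_lineWord (colBox lam mu) hc hs.monotone_col
      (hrc ▸ ht.monotone_col)]
  · refine Or.inr ?_
    rw [hrc, fillingWeight_comp_of_comp_eq s (mem_lineGroup_colBox.1 hc)] at hlt
    exact hlt

theorem thetaCoeff_triangular (ht : IsCostandard p t) (hs : IsCostandard p s)
    (h : thetaCoeff (rowBox lam mu) (colBox lam mu) p t s ≠ 0) :
    s = t ∨ colWeight s < colWeight t := by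
  obtain ⟨y, -, hy⟩ := Finset.exists_ne_zero_of_sum_ne_zero h
  obtain ⟨hrow, hcol⟩ := eq_comp_and_eq_comp_of_mul_ne_zero _ _ _ hy
  exact (ht.eq_or_colWeight_lt hs hrow hcol).imp_left And.right

theorem isUnit_thetaCoeff_self (ht : IsCostandard p t) :
    IsUnit (thetaCoeff (rowBox lam mu) (colBox lam mu) p t t) := by
  have hrow := prod_dualCoeff_comp (rowBox lam mu) (p + 1) ht.isLineRestricted_row (one_mem _)
  have hcol := prod_dualCoeff_comp (colBox lam mu) p ht.isLineRestricted_col (one_mem _)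
  rw [Equiv.Perm.coe_one, Function.comp_id, lineSign_mul_self] at hrow hcol
  rw [thetaCoeff, Finset.sum_eq_single t]
  · rw [hrow, hcol, one_mul, mul_one]
    exact (IsUnit.of_mul_eq_one _ (shiftSign_mul_self _ _)).mul
      (IsUnit.of_mul_eq_one _ (relSign_mul_self _ _ _))
  · intro y _ hyt
    by_contra hy
    obtain ⟨hrow, hcol⟩ := eq_comp_and_eq_comp_of_mul_ne_zero _ _ _ hy
    rcases ht.eq_or_colWeight_lt ht hrow hcol with ⟨h, -⟩ | h
    · exact hyt h
    · exact lt_irrefl _ h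
  · exact fun h => absurd (Finset.mem_univ t) h

end Triangularity

section IntegralStraightening

variable {lam mu : YoungDiagram} {ι : Type} [LinearOrder ι] [Fintype ι] {p : ι → ZMod 2}

theorem exists_rat_thetaCoeff_eq_sum [Fintype {t : Tableau lam mu ι // IsCostandard p t}]
    {x : Tableau lam mu ι} (hx : IsLineRestricted (rowBox lam mu) (p + 1) x) :
    ∃ c : {t : Tableau lam mu ι // IsCostandard p t} → ℚ,
      ∀ s, IsLineRestricted (colBox lam mu) p s →
        (thetaCoeff (rowBox lam mu) (colBox lam mu) p x s : ℚ) =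
          ∑ t, thetaCoeff (rowBox lam mu) (colBox lam mu) p t.1 s • c t := by
  obtain ⟨d, hd⟩ :=
    (Submodule.mem_span_range_iff_exists_fun ℚ).1 (symVec_mem_span_isCostandard (p := p) x)
  let a (y : Tableau lam mu ι) : ℚ := stabilizerCard (rowBox lam mu) y *
    shiftSign (lineRank (rowBox lam mu)) ((p + 1) ∘ y)
  let b (s : Tableau lam mu ι) : ℚ := stabilizerCard (colBox lam mu) s *
    relSign (lineRank (rowBox lam mu)) (lineRank (colBox lam mu)) (p ∘ s)
  have ha : a x ≠ 0 := mul_ne_zero (Nat.cast_ne_zero.2 (stabilizerCard_pos _ x).ne')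
    (Int.cast_ne_zero.2 (left_ne_zero_of_mul_eq_one (shiftSign_mul_self _ _)))
  have hb (s) : b s ≠ 0 := mul_ne_zero (Nat.cast_ne_zero.2 (stabilizerCard_pos _ s).ne')
    (Int.cast_ne_zero.2 (left_ne_zero_of_mul_eq_one (relSign_mul_self _ _ _)))
  have hsym {y s} (hy : IsLineRestricted (rowBox lam mu) (p + 1) y)
      (hs : IsLineRestricted (colBox lam mu) p s) :
      symVec p y s = a y * b s * thetaCoeff (rowBox lam mu) (colBox lam mu) p y s := by
    rw [symVec, symCoeff_eq_mul_thetaCoeff _ _ p hy hs]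
    push_cast
    rfl
  refine ⟨fun t => d t * a t.1 / a x, fun s hs => ?_⟩
  have hds := congrFun hd s
  rw [Finset.sum_apply, hsym hx hs] at hds
  refine mul_left_cancel₀ (mul_ne_zero ha (hb s)) ?_
  rw [← hds, Finset.mul_sum]
  refine Finset.sum_congr rfl fun t _ => ?_
  rw [Pi.smul_apply, hsym t.2.isLineRestricted_row hs, zsmul_eq_mul, smul_eq_mul]
  field_simp

theorem exists_int_thetaCoeff_eq_sum [Fintype {t : Tableau lam mu ι // IsCostandard p t}]
    {x : Tableau lam mu ι} (hx : IsLineRestricted (rowBox lam mu) (p + 1) x) :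
    ∃ c : {t : Tableau lam mu ι // IsCostandard p t} → ℤ,
      ∀ s, IsLineRestricted (colBox lam mu) p s →
        thetaCoeff (rowBox lam mu) (colBox lam mu) p x s =
          ∑ t, c t * thetaCoeff (rowBox lam mu) (colBox lam mu) p t.1 s := by
  obtain ⟨c, hc⟩ := exists_rat_thetaCoeff_eq_sum hx
  have hrange : ∀ s : {t : Tableau lam mu ι // IsCostandard p t},
      ∑ t : {t : Tableau lam mu ι // IsCostandard p t},
          thetaCoeff (rowBox lam mu) (colBox lam mu) p t.1 s.1 • c t ∈
        LinearMap.range (Algebra.linearMap ℤ ℚ) := fun s => by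
    rw [← hc s.1 s.2.isLineRestricted_col]
    exact LinearMap.mem_range_self (Algebra.linearMap ℤ ℚ) _
  have hint : ∀ t, c t ∈ LinearMap.range (Algebra.linearMap ℤ ℚ) :=
    mem_of_forall_sum_mem_of_triangular
      (wt := fun t : {t : Tableau lam mu ι // IsCostandard p t} => colWeight t.1)
      (fun t => isUnit_thetaCoeff_self t.2)
      (fun t s h => (thetaCoeff_triangular t.2 s.2 h).imp_left Subtype.ext) hrange
  choose z hz using hint
  refine ⟨z, fun s hs => Int.cast_injective (α := ℚ) ?_⟩
  rw [hc s hs, Int.cast_sum]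
  refine Finset.sum_congr rfl fun t _ => ?_
  rw [← hz t, zsmul_eq_mul, mul_comm, Int.cast_mul, Algebra.linearMap_apply, eq_intCast]

end IntegralStraightening

section SymmetricPowers

variable {k : Type u} [Field k] {M : Type v} [AddCommGroup M] [Module k M]
  {G : ZMod 2 → Submodule k M} {d : ℕ}

theorem symMul_tprod_swap {v : Fin d → M} {a b : Fin d} {α β : ZMod 2} (hab : (a : ℕ) + 1 = b)
    (ha : v a ∈ G α) (hb : v b ∈ G β) :
    symMul G d (PiTensorProduct.tprod k v) =
      (koszul α β : k) • symMul G d (PiTensorProduct.tprod k fun s => v (Equiv.swap a b s)) := by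
  rw [← map_smul, ← sub_eq_zero, ← map_sub]
  exact (Submodule.Quotient.mk_eq_zero _).2
    (Submodule.subset_span ⟨v, a, b, α, β, hab, ha, hb, rfl⟩)

theorem symMul_tprod_eq_zero (hk : (2 : k) ≠ 0) {v : Fin d → M} {a b : Fin d}
    (hab : (a : ℕ) + 1 = b) (hv : v a = v b) (ha : v a ∈ G 1) :
    symMul G d (PiTensorProduct.tprod k v) = 0 := by
  have hneg := symMul_tprod_swap hab ha (hv ▸ ha)
  rw [show (fun s => v (Equiv.swap a b s)) = v from comp_swap_eq_self v hv,
    show koszul 1 1 = -1 from rfl, Int.cast_neg, Int.cast_one, neg_one_smul] at hneg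
  have htwo : (2 : k) • symMul G d (PiTensorProduct.tprod k v) = 0 := by
    rw [two_smul]
    exact eq_neg_iff_add_eq_zero.1 hneg
  exact (smul_eq_zero.1 htwo).resolve_left hk

theorem symMul_tprod_comp_mem_span {v : Fin d → M} {ε : Fin d → ZMod 2}
    (hv : ∀ s, v s ∈ G (ε s)) (σ : Equiv.Perm (Fin d)) :
    symMul G d (PiTensorProduct.tprod k (v ∘ σ)) ∈
      Submodule.span k {symMul G d (PiTensorProduct.tprod k v)} := by
  cases d with
  | zero =>
    rw [Subsingleton.elim (v ∘ σ) v]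
    exact Submodule.mem_span_singleton_self _
  | succ d =>
  have hσ : σ ∈ Submonoid.closure (Set.range fun i : Fin d => Equiv.swap i.castSucc i.succ) := by
    rw [Equiv.Perm.mclosure_swap_castSucc_succ]
    exact Submonoid.mem_top σ
  induction hσ using Submonoid.closure_induction_right with
  | one => exact Submodule.mem_span_singleton_self _
  | mul_right σ _ τ hτ ih =>
    obtain ⟨i, rfl⟩ := hτ
    have hswap : (fun s => (v ∘ (σ * Equiv.swap i.castSucc i.succ))
        (Equiv.swap i.castSucc i.succ s)) = v ∘ σ :=
      funext fun s => congrArg (v ∘ σ) (Equiv.swap_apply_self _ _ _)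
    rw [symMul_tprod_swap (v := v ∘ (σ * Equiv.swap i.castSucc i.succ)) (a := i.castSucc)
      (b := i.succ) rfl (hv _) (hv _), hswap]
    exact Submodule.smul_mem _ _ ih

variable {N : Type*} [AddCommGroup N] [Module k N] {H : ZMod 2 → Submodule k N}

theorem symRel_le_ker_symMul_comp_map {φ : M →ₗ[k] N} (hφ : ∀ ε, ∀ v ∈ G ε, φ v ∈ H ε) (d : ℕ) :
    symRel G d ≤ LinearMap.ker (symMul H d ∘ₗ PiTensorProduct.map fun _ => φ) := by
  refine Submodule.span_le.2 ?_
  rintro _ ⟨v, a, b, α, β, hab, ha, hb, rfl⟩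
  rw [SetLike.mem_coe, LinearMap.mem_ker, map_sub, map_smul, sub_eq_zero]
  simp only [LinearMap.comp_apply, PiTensorProduct.map_tprod]
  exact symMul_tprod_swap hab (hφ _ _ ha) (hφ _ _ hb)

variable (φ : M →ₗ[k] N) (hφ : ∀ ε, ∀ v ∈ G ε, φ v ∈ H ε)

/-- The functoriality of the symmetric power in even linear maps. -/
def symMap (d : ℕ) : SymPow G d →ₗ[k] SymPow H d :=
  symLift G d (symMul H d ∘ₗ PiTensorProduct.map fun _ => φ)
    (symRel_le_ker_symMul_comp_map hφ d)

theorem symMap_symMul_tprod (v : Fin d → M) :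
    symMap φ hφ d (symMul G d (PiTensorProduct.tprod k v)) =
      symMul H d (PiTensorProduct.tprod k fun s => φ (v s)) := by
  rw [symMap, symLift_symMul, LinearMap.comp_apply, PiTensorProduct.map_tprod]

theorem eval_mem_dualGrading {ε : ZMod 2} {v : M} (hv : v ∈ G ε) :
    Module.Dual.eval k M v ∈ dualGrading (dualGrading G) ε :=
  fun _ hδ _ hf => hf ε hδ.symm v hv

end SymmetricPowers

section HomogeneousBases

variable {k : Type u} [Field k] {M : Type v} [AddCommGroup M] [Module k M]
  {G : ZMod 2 → Submodule k M} {ι : Type} {b : Module.Basis ι k M} {p : ι → ZMod 2}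

/-- A homogeneous basis `b` of a superspace with homogeneous components `G`, the vector `b j` having
parity `p j`. Membership in the components is expressed by coordinates, so that the notion passes
to the dual superspace, whose components are not given with a decomposition. -/
structure IsHomogeneousBasis (G : ZMod 2 → Submodule k M) (b : Module.Basis ι k M)
    (p : ι → ZMod 2) : Prop where
  mem : ∀ j, b j ∈ G (p j)
  coord_eq_zero : ∀ ⦃ε : ZMod 2⦄ ⦃v : M⦄, v ∈ G ε → ∀ ⦃j : ι⦄, p j ≠ ε → b.coord j v = 0

theorem isHomogeneousBasis_of_mem [DirectSum.Decomposition G] (hb : ∀ j, b j ∈ G (p j)) :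
    IsHomogeneousBasis G b p where
  mem := hb
  coord_eq_zero ε v hv j hj := by
    have hcoord : b.coord j ∘ₗ superProj G ε = 0 := b.ext fun i => by
      rw [LinearMap.comp_apply, superProj_of_mem G ε (hb i), LinearMap.zero_apply]
      split_ifs with hi
      · rw [Module.Basis.coord_apply, Module.Basis.repr_self,
          Finsupp.single_eq_of_ne fun h => hj ((congrArg p h).trans hi.symm)]
      · exact map_zero _
    have hzero := LinearMap.congr_fun hcoord v
    rwa [LinearMap.comp_apply, superProj_of_mem G ε hv, if_pos rfl] at hzero

theorem IsHomogeneousBasis.parityShift (hb : IsHomogeneousBasis G b p) :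
    IsHomogeneousBasis (parityShift G) b (p + 1) where
  mem j := by
    rw [SuperSchur.parityShift, Pi.add_apply, Pi.one_apply, add_assoc, CharTwo.add_self_eq_zero,
      add_zero]
    exact hb.mem j
  coord_eq_zero ε v hv j hj := hb.coord_eq_zero hv fun h => hj (by
    rw [Pi.add_apply, h, Pi.one_apply, add_assoc, CharTwo.add_self_eq_zero, add_zero])

variable [LinearOrder ι] {d : ℕ}

/-- The nondecreasing words in which no odd letter is repeated: they index the standard basis of a
symmetric power. -/
abbrev SortedWord (p : ι → ZMod 2) (d : ℕ) : Type :=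
  {w : Fin d → ι // Monotone w ∧ IsRestricted p w}

/-- The monomial of a word in the vectors of a basis. -/
def symMonomial (G : ZMod 2 → Submodule k M) (b : Module.Basis ι k M) (x : Fin d → ι) :
    SymPow G d :=
  symMul G d (PiTensorProduct.tprod k fun s => b (x s))

theorem dualCoeff_sortedWord (w x : SortedWord p d) :
    dualCoeff p w.1 x.1 = if x = w then 1 else 0 := by
  split_ifs with h
  · rw [h, dualCoeff, if_pos ⟨w.2.2, 1, fun _ => rfl⟩, wordSign_mul_self]
  · rw [dualCoeff, if_neg]
    rintro ⟨-, τ, hτ⟩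
    have hcomp : x.1 = w.1 ∘ τ := funext hτ
    exact h (Subtype.ext (hcomp.trans
      (Tuple.unique_monotone (τ := Equiv.refl _) (hcomp ▸ x.2.1) w.2.1)))

theorem symMonomial_eq_zero (hk : (2 : k) ≠ 0) (hb : IsHomogeneousBasis G b p) {x : Fin d → ι}
    (hx : Monotone x) (hr : ¬ IsRestricted p x) : symMonomial G b x = 0 := by
  unfold IsRestricted at hr
  push Not at hr
  obtain ⟨s, t, hst, hodd, hne⟩ := hr
  wlog hlt : s < t generalizing s t
  · exact this t s hst.symm (hst ▸ hodd) hne.symm (hne.lt_or_gt.resolve_left hlt)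
  have hsucc : (s : ℕ) + 1 < d := (Nat.succ_le_of_lt hlt).trans_lt t.2
  have hrep : x s = x ⟨s + 1, hsucc⟩ :=
    le_antisymm (hx (Fin.le_def.2 (Nat.le_succ _))) (hst ▸ hx (Fin.le_def.2 hlt))
  exact symMul_tprod_eq_zero (b := ⟨s + 1, hsucc⟩) hk rfl (congrArg b hrep) (hodd ▸ hb.mem (x s))

theorem symMonomial_mem_span (hk : (2 : k) ≠ 0) (hb : IsHomogeneousBasis G b p) (x : Fin d → ι) :
    symMonomial G b x ∈
      Submodule.span k (Set.range fun w : SortedWord p d => symMonomial G b w.1) := by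
  have hsort : symMonomial G b x ∈ Submodule.span k {symMonomial G b (x ∘ Tuple.sort x)} := by
    have hmem := symMul_tprod_comp_mem_span
      (fun s => hb.mem ((x ∘ Tuple.sort x) s)) (Tuple.sort x).symm
    rwa [show (fun s => b ((x ∘ Tuple.sort x) s)) ∘ (Tuple.sort x).symm = fun s => b (x s) from
      funext fun s => congrArg (fun a => b (x a)) ((Tuple.sort x).apply_symm_apply s)] at hmem
  refine (Submodule.span_singleton_le_iff_mem _ _).2 ?_ hsort
  by_cases hr : IsRestricted p (x ∘ Tuple.sort x)
  · exact Submodule.subset_span ⟨⟨_, Tuple.monotone_sort x, hr⟩, rfl⟩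
  · rw [symMonomial_eq_zero hk hb (Tuple.monotone_sort x) hr]
    exact Submodule.zero_mem _

theorem span_range_symMonomial (hk : (2 : k) ≠ 0) (hb : IsHomogeneousBasis G b p) (d : ℕ) :
    ⊤ ≤ Submodule.span k (Set.range fun w : SortedWord p d => symMonomial G b w.1) := by
  have htop : (⊤ : Submodule k (SymPow G d)) = (⊤ : Submodule k (⨂[k]^d M)).map (symMul G d) := by
    rw [Submodule.map_top]
    exact (Submodule.range_mkQ (symRel G d)).symm
  rw [htop, ← (Basis.piTensorProduct fun _ : Fin d => b).span_eq, Submodule.map_span,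
    Submodule.span_le]
  rintro _ ⟨_, ⟨x, rfl⟩, rfl⟩
  rw [Basis.piTensorProduct_apply]
  exact symMonomial_mem_span hk hb x

theorem IsHomogeneousBasis.dual [Finite ι] (hb : IsHomogeneousBasis G b p) :
    IsHomogeneousBasis (dualGrading G) b.dualBasis p where
  mem j δ hδ v hv := by
    rw [Module.Basis.coe_dualBasis]
    exact hb.coord_eq_zero hv hδ.symm
  coord_eq_zero ε f hf j hj := by
    rw [Module.Basis.coord_apply, Module.Basis.dualBasis_repr]
    exact hf _ hj _ (hb.mem j)

/-- The functional on `S^d M` that takes the coordinate at the monomial of the word `w`: it is the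
divided power monomial of the dual basis, for the canonical map `M → M^{**}`. -/
def symCoord [Fintype ι] (hb : IsHomogeneousBasis G b p) (w : Fin d → ι) :
    Module.Dual k (SymPow G d) :=
  divMonomial (dualGrading G) b.dualBasis p hb.dual.mem w ∘ₗ
    symMap (Module.Dual.eval k M) (fun _ _ => eval_mem_dualGrading) d

theorem symCoord_symMonomial [Fintype ι] (hb : IsHomogeneousBasis G b p) (w x : Fin d → ι) :
    symCoord hb w (symMonomial G b x) = dualCoeff p w x := by
  have heval (j : ι) : Module.Dual.eval k M (b j) = b.dualBasis.coord j :=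
    LinearMap.ext fun f => (b.dualBasis_repr f j).symm
  rw [symCoord, symMonomial, LinearMap.comp_apply, symMap_symMul_tprod]
  simp only [heval]
  exact divMonomial_monomial _ _ _ _ _ _

theorem linearIndependent_symMonomial [Finite ι] (hb : IsHomogeneousBasis G b p) (d : ℕ) :
    LinearIndependent k fun w : SortedWord p d => symMonomial G b w.1 := by
  cases nonempty_fintype ι
  refine LinearIndependent.of_pairwise_dual_eq_zero_one _ (fun w => symCoord hb w.1) ?_ ?_
  · intro w x hwx
    rw [symCoord_symMonomial, dualCoeff_sortedWord, if_neg hwx.symm, Int.cast_zero]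
  · intro w
    rw [symCoord_symMonomial, dualCoeff_sortedWord, if_pos rfl, Int.cast_one]

variable [Fintype ι]

/-- The basis of a symmetric power formed by the monomials of the sorted words. -/
def symBasis (hk : (2 : k) ≠ 0) (hb : IsHomogeneousBasis G b p) (d : ℕ) :
    Module.Basis (SortedWord p d) k (SymPow G d) :=
  Module.Basis.mk (linearIndependent_symMonomial hb d) (span_range_symMonomial hk hb d)

theorem symBasis_apply (hk : (2 : k) ≠ 0) (hb : IsHomogeneousBasis G b p) (w : SortedWord p d) :
    symBasis hk hb d w = symMonomial G b w.1 :=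
  Module.Basis.mk_apply _ _ _

theorem symBasis_repr_symMonomial (hk : (2 : k) ≠ 0) (hb : IsHomogeneousBasis G b p)
    (x : Fin d → ι) (w : SortedWord p d) :
    (symBasis hk hb d).repr (symMonomial G b x) w = dualCoeff p w.1 x := by
  have hcoord : (symBasis hk hb d).coord w = symCoord hb w.1 :=
    (symBasis hk hb d).ext fun y => by
      rw [Module.Basis.coord_apply, Module.Basis.repr_self, symBasis_apply, symCoord_symMonomial,
        dualCoeff_sortedWord, Finsupp.single_apply, Int.cast_ite, Int.cast_one, Int.cast_zero]
  rw [← symCoord_symMonomial hb, ← hcoord, Module.Basis.coord_apply]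

/-- The basis of a divided power formed by the divided power monomials of the sorted words. -/
def divBasis (hk : (2 : k) ≠ 0) (hb : IsHomogeneousBasis G b p) (d : ℕ) :
    Module.Basis (SortedWord p d) k (DivPow G d) :=
  (symBasis hk hb.dual d).dualBasis

theorem divBasis_apply (hk : (2 : k) ≠ 0) (hb : IsHomogeneousBasis G b p) (w : SortedWord p d) :
    divBasis hk hb d w = divMonomial G b p hb.mem w.1 := by
  refine (symBasis hk hb.dual d).ext fun x => ?_
  rw [divBasis, Module.Basis.dualBasis_apply_self, symBasis_apply, symMonomial,
    Module.Basis.coe_dualBasis, divMonomial_monomial, dualCoeff_sortedWord, Int.cast_ite,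
    Int.cast_one, Int.cast_zero]

theorem divComul_divMonomial [Module.Finite k M] (hb : ∀ j, b j ∈ G (p j)) (x : Fin d → ι) :
    divComul G d (divMonomial G b p hb x) =
      ∑ y : Fin d → ι, (dualCoeff p x y : k) • PiTensorProduct.tprod k fun s => b (y s) := by
  rw [divComul, LinearMap.comp_apply, LinearEquiv.coe_coe, LinearEquiv.symm_apply_eq]
  refine PiTensorProduct.ext (MultilinearMap.ext fun f => ?_)
  simp only [LinearMap.compMultilinearMap_apply, map_sum, map_smul, LinearMap.sum_apply,
    LinearMap.smul_apply, tensorEval_tprod, smul_eq_mul]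
  exact dualFunctional_tprod b p x f

end HomogeneousBases

section Concatenation

variable (k : Type u) [Field k] {M : Type v} [AddCommGroup M] [Module k M]
  {q : ℕ} (n : Fin q → ℕ) (v : (Σ i : Fin q, Fin (n i)) → M)

theorem concat_tprod :
    concat k M n (PiTensorProduct.tprod k fun i => PiTensorProduct.tprod k fun s => v ⟨i, s⟩) =
      PiTensorProduct.tprod k (v ∘ finSigmaFinEquiv.symm) := by
  rw [concat, LinearEquiv.trans_apply, ← tensorSigmaEquiv_tprod, LinearEquiv.symm_apply_apply,
    PiTensorProduct.reindex_tprod]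
  rfl

theorem concat_symm_tprod :
    (concat k M n).symm (PiTensorProduct.tprod k (v ∘ finSigmaFinEquiv.symm)) =
      PiTensorProduct.tprod k fun i => PiTensorProduct.tprod k fun s => v ⟨i, s⟩ :=
  (LinearEquiv.symm_apply_eq _).2 (concat_tprod k n v).symm

end Concatenation

section LineWords

variable {β ι : Type*} {q : ℕ} {n : Fin q → ℕ} (e : (Σ i : Fin q, Fin (n i)) ≃ β)

/-- The fillings of a diagram are the families of words in its lines. -/
def lineWordEquiv : (β → ι) ≃ (∀ i, Fin (n i) → ι) :=
  (Equiv.arrowCongr e.symm (Equiv.refl ι)).trans (Equiv.piCurry fun _ _ => ι)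

theorem lineWord_lineWordEquiv_symm (w : ∀ i, Fin (n i) → ι) (i : Fin q) :
    lineWord e ((lineWordEquiv e).symm w) i = w i :=
  congrFun ((lineWordEquiv e).apply_symm_apply w) i

theorem isLineRestricted_lineWordEquiv_symm {ι : Type} [LinearOrder ι] {p : ι → ZMod 2}
    (w : ∀ i, SortedWord p (n i)) :
    IsLineRestricted e p ((lineWordEquiv e).symm fun i => (w i).1) := by
  rw [isLineRestricted_iff]
  intro i
  rw [lineWord_lineWordEquiv_symm]
  exact (w i).2.2

end LineWords

section Theta

variable {k : Type u} [Field k] {M : Superspace.{u, v} k} {lam mu : YoungDiagram}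
  {ι : Type} {Z : Module.Basis ι k M.carrier} {p : ι → ZMod 2}

theorem mulConj_superPerm_tprod (hZ : ∀ i, Z i ∈ M.grading (p i)) (y : Tableau lam mu ι) :
    mulConj M lam mu (superPerm M.grading (sigmaConj lam mu)
      (PiTensorProduct.tprod k (Z ∘ y ∘ (rowNumber lam mu).symm))) =
      (relSign (rowNumber lam mu) (colNumber lam mu) (p ∘ y) : k) •
        PiTensorProduct.tprod k fun j =>
          symMonomial M.grading Z (lineWord (colBox lam mu) y j) := by
  have hconcat := concat_symm_tprod k (skewCol lam mu) (Z ∘ y ∘ colBox lam mu)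
  rw [superPerm_tprod M.grading _ (Z ∘ y ∘ (rowNumber lam mu).symm)
    ((p ∘ y) ∘ (rowNumber lam mu).symm) fun s => hZ _, sigmaConj, superSign_eq_relSign, map_smul]
  simp only [Function.comp_apply, Equiv.trans_apply, Equiv.symm_apply_apply]
  refine congrArg _ ((congrArg (PiTensorProduct.map _) hconcat).trans ?_)
  exact PiTensorProduct.map_tprod _ _

variable [LinearOrder ι] [Fintype ι]

theorem deltaPi_gammaPiMonomial (hZ : ∀ i, Z i ∈ M.grading (p i)) (x : Tableau lam mu ι) :
    deltaPi M lam mu (gammaPiMonomial Z p hZ x) =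
      ∑ y : Tableau lam mu ι,
        (((∏ i, dualCoeff (p + 1) (lineWord (rowBox lam mu) x i) (lineWord (rowBox lam mu) y i)) *
          shiftSign (rowNumber lam mu) ((p + 1) ∘ y) : ℤ) : k) •
        PiTensorProduct.tprod k (Z ∘ y ∘ (rowNumber lam mu).symm) := by
  unfold deltaPi gammaPiMonomial
  simp only [LinearMap.comp_apply, PiTensorProduct.map_tprod, divComul_divMonomial,
    MultilinearMap.map_sum, MultilinearMap.map_smul_univ, map_sum, map_smul, LinearEquiv.coe_coe]
  refine (Fintype.sum_equiv (lineWordEquiv (rowBox lam mu)) _ _ fun y => ?_).symm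
  have hconcat := concat_tprod k (skewRow lam mu) (Z ∘ y ∘ rowBox lam mu)
  have hshift := shiftTensor_tprod M.grading (Z ∘ y ∘ (rowNumber lam mu).symm)
    (((p + 1) ∘ y) ∘ (rowNumber lam mu).symm) fun s => mem_parityShift Z p hZ _
  rw [prod_koszul_one_eq_shiftSign] at hshift
  rw [Int.cast_mul, mul_smul, Int.cast_prod]
  refine congrArg _ (hshift.symm.trans (congrArg _ hconcat.symm))

theorem thetaConj_gammaPiMonomial (hZ : ∀ i, Z i ∈ M.grading (p i)) (x : Tableau lam mu ι) :
    thetaConj M lam mu (gammaPiMonomial Z p hZ x) =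
      ∑ y : Tableau lam mu ι,
        (((∏ i, dualCoeff (p + 1) (lineWord (rowBox lam mu) x i) (lineWord (rowBox lam mu) y i)) *
          shiftSign (rowNumber lam mu) ((p + 1) ∘ y) : ℤ) : k) •
        (relSign (rowNumber lam mu) (colNumber lam mu) (p ∘ y) : k) •
        PiTensorProduct.tprod k fun j =>
          symMonomial M.grading Z (lineWord (colBox lam mu) y j) := by
  simp only [thetaConj, LinearMap.comp_apply, deltaPi_gammaPiMonomial, map_sum, map_smul,
    mulConj_superPerm_tprod hZ]

/-- The basis of `S^{lam'/mu'}(M)` formed by the tensor products of monomials. -/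
def symConjBasis (hk : (2 : k) ≠ 0) (hZ : ∀ i, Z i ∈ M.grading (p i)) (lam mu : YoungDiagram) :
    Module.Basis ((j : Fin (lam.rowLen 0)) → SortedWord p (skewCol lam mu j)) k
      (SymConj M lam mu) :=
  Basis.piTensorProduct fun j => symBasis hk (isHomogeneousBasis_of_mem hZ) (skewCol lam mu j)

theorem symConjBasis_repr_thetaConj (hk : (2 : k) ≠ 0) (hZ : ∀ i, Z i ∈ M.grading (p i))
    (x : Tableau lam mu ι) {s : Tableau lam mu ι}
    {w : (j : Fin (lam.rowLen 0)) → SortedWord p (skewCol lam mu j)}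
    (hs : ∀ j, lineWord (colBox lam mu) s j = (w j).1) :
    (symConjBasis hk hZ lam mu).repr (thetaConj M lam mu (gammaPiMonomial Z p hZ x)) w =
      (thetaCoeff (rowBox lam mu) (colBox lam mu) p x s : k) := by
  rw [thetaConj_gammaPiMonomial, thetaCoeff, map_sum, Finsupp.finsetSum_apply, Int.cast_sum]
  refine Finset.sum_congr rfl fun y _ => ?_
  rw [map_smul, map_smul, Finsupp.smul_apply, Finsupp.smul_apply, symConjBasis,
    Basis.piTensorProduct_repr_tprod_apply]
  simp only [symBasis_repr_symMonomial, hs, Int.cast_mul, Int.cast_prod]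
  rfl

theorem thetaConj_gammaPiMonomial_mem_span (hk : (2 : k) ≠ 0) (hZ : ∀ i, Z i ∈ M.grading (p i))
    {x : Tableau lam mu ι} (hx : IsLineRestricted (rowBox lam mu) (p + 1) x) :
    thetaConj M lam mu (gammaPiMonomial Z p hZ x) ∈ Submodule.span k
      (Set.range fun t : {t : Tableau lam mu ι // IsCostandard p t} =>
        thetaConj M lam mu (gammaPiMonomial Z p hZ t.1)) := by
  classical
  obtain ⟨c, hc⟩ := exists_int_thetaCoeff_eq_sum hx
  refine (Submodule.mem_span_range_iff_exists_fun k).2 ⟨fun t => c t, ?_⟩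
  refine (symConjBasis hk hZ lam mu).ext_elem fun w => ?_
  have hw := lineWord_lineWordEquiv_symm (colBox lam mu) fun j => (w j).1
  rw [map_sum, Finsupp.finsetSum_apply, symConjBasis_repr_thetaConj hk hZ x hw,
    hc _ (isLineRestricted_lineWordEquiv_symm _ w), Int.cast_sum]
  refine Finset.sum_congr rfl fun t _ => ?_
  rw [map_smul, Finsupp.smul_apply, symConjBasis_repr_thetaConj hk hZ _ hw, Int.cast_mul,
    smul_eq_mul]

theorem schurConj_le_span (hk : (2 : k) ≠ 0) (hZ : ∀ i, Z i ∈ M.grading (p i)) :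
    schurConj M lam mu ≤ Submodule.span k
      (Set.range fun t : {t : Tableau lam mu ι // IsCostandard p t} =>
        thetaConj M lam mu (gammaPiMonomial Z p hZ t.1)) := by
  let B := Basis.piTensorProduct fun i : Fin (lam.colLen 0) =>
    divBasis hk (isHomogeneousBasis_of_mem hZ).parityShift (skewRow lam mu i)
  rw [schurConj, LinearMap.range_eq_map, ← B.span_eq, Submodule.map_span, Submodule.span_le]
  rintro _ ⟨_, ⟨w, rfl⟩, rfl⟩
  have hB : B w =
      gammaPiMonomial Z p hZ ((lineWordEquiv (rowBox lam mu)).symm fun i => (w i).1) := by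
    simp only [B, Basis.piTensorProduct_apply, divBasis_apply]
    refine congrArg _ (funext fun i => ?_)
    exact congrArg _ (lineWord_lineWordEquiv_symm (rowBox lam mu) (fun i => (w i).1) i).symm
  rw [hB]
  exact thetaConj_gammaPiMonomial_mem_span hk hZ (isLineRestricted_lineWordEquiv_symm _ w)

theorem linearIndependent_thetaConj (hk : (2 : k) ≠ 0) (hZ : ∀ i, Z i ∈ M.grading (p i)) :
    LinearIndependent k fun t : {t : Tableau lam mu ι // IsCostandard p t} =>
      thetaConj M lam mu (gammaPiMonomial Z p hZ t.1) := by
  classical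
  rw [Fintype.linearIndependent_iff]
  intro g hg
  refine mem_of_forall_sum_mem_of_triangular (S := (⊥ : Submodule ℤ k))
    (wt := fun t : {t : Tableau lam mu ι // IsCostandard p t} => colWeight t.1)
    (fun t => isUnit_thetaCoeff_self t.2)
    (fun t s h => (thetaCoeff_triangular t.2 s.2 h).imp_left Subtype.ext) fun s => ?_
  let w (j : Fin (lam.rowLen 0)) : SortedWord p (skewCol lam mu j) :=
    ⟨lineWord (colBox lam mu) s.1 j, s.2.monotone_col j,
      (isLineRestricted_iff _ p s.1).1 s.2.isLineRestricted_col j⟩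
  have hrepr := DFunLike.congr_fun (congrArg (symConjBasis hk hZ lam mu).repr hg) w
  rw [map_sum, Finsupp.finsetSum_apply, map_zero, Finsupp.zero_apply] at hrepr
  rw [Submodule.mem_bot, ← hrepr]
  refine Finset.sum_congr rfl fun t _ => ?_
  rw [map_smul, Finsupp.smul_apply, symConjBasis_repr_thetaConj hk hZ t.1 (s := s.1) fun _ => rfl,
    zsmul_eq_mul, smul_eq_mul, mul_comm]

end Theta

end SuperSchur

end

theorem mainTheorem9_general {k : Type u} [Field k] (hk : ringChar k ≠ 2)
    (M : SuperSchur.Superspace.{u, v} k) {ι : Type} [LinearOrder ι] [Fintype ι]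
    (Z : Module.Basis ι k M.carrier) (p : ι → ZMod 2) (hZ : ∀ i, Z i ∈ M.grading (p i))
    (lam mu : YoungDiagram) :
    ∃ B : Module.Basis {t : SuperSchur.Tableau lam mu ι // SuperSchur.IsCostandard p t} k
        (SuperSchur.schurConj M lam mu),
      ∀ t, (B t : SuperSchur.SymConj M lam mu) =
        SuperSchur.thetaConj M lam mu (SuperSchur.gammaPiMonomial Z p hZ t.1) := by
  have htwo : (2 : k) ≠ 0 := Ring.two_ne_zero hk
  have hli := SuperSchur.linearIndependent_thetaConj (lam := lam) (mu := mu) htwo hZ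
  have hspan := (SuperSchur.schurConj_le_span (lam := lam) (mu := mu) htwo hZ).antisymm
    (Submodule.span_le.2 (Set.range_subset_iff.2 fun t => LinearMap.mem_range_self _ _))
  refine ⟨(Module.Basis.span hli).map (LinearEquiv.ofEq _ _ hspan.symm), fun t => ?_⟩
  rw [Module.Basis.map_apply, LinearEquiv.coe_ofEq_apply, Module.Basis.span_apply]

theorem mainTheorem9 {k : Type u} [Field k] (hk : ringChar k ≠ 2)
    (V : SuperSchur.CliffordSupermodule.{u, v} k) (n : ℕ)
    (Z : Module.Basis (Fin (n + n)) k V.forget.carrier) (p : Fin (n + n) → ZMod 2)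
    (hZ : ∀ i, Z i ∈ V.forget.grading (p i))
    (lam mu : YoungDiagram) (hmu : mu ≤ lam) :
    ∃ B : Module.Basis
        {t : SuperSchur.Tableau lam mu (Fin (n + n)) // SuperSchur.IsCostandard p t} k
        (SuperSchur.schurConjII lam mu V),
      ∀ t, (B t : SuperSchur.SymConj V.forget lam mu) =
        SuperSchur.thetaConjII lam mu V (SuperSchur.gammaPiMonomial Z p hZ t.1) :=
  mainTheorem9_general hk V.forget Z p hZ lam mu
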